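/- Let $q\in\mathbb C$ with $0<|q|<1$. For $a\in\mathbb C$ put $(a)_\infty=\prod_{j\ge 0}(1-aq^j)$ and, for $k\in\mathbb Z$, let $(a)_k=(a)_\infty/(aq^k)_\infty$, i.e. $(a)_k=\prod_{0\le j<k}(1-aq^j)$ if $k\ge 0$ and $(a)_k=\prod_{j=1}^{-k}(1-aq^{-j})^{-1}$ if $k<0$ (a quotient with such a factor in its denominator is read as $0$ if $(1-aq^{-j})=0$ for some $1\le j\le -k$). Write $(a_1,\dots,a_r)_k=(a_1)_k\cdots(a_r)_k$ for $k\in\mathbb Z\cup\{\infty\}$, and $${}_4\phi_3\!\left[\begin{matrix}a_1,a_2,a_3,a_4\\ b_1,b_2,b_3\end{matrix};q,z\right]=\sum_{k\ge 0}\frac{(a_1,a_2,a_3,a_4)_k}{(q,b_1,b_2,b_3)_k}z^k .$$ **Theorem.** Let $m\ge 0$ be an integer and let $\beta,\gamma,\rho$ be nonzero real numbers with $|q/\beta^2|<1$, such that no denominator below vanishes, that is: $\beta q^j\ne 1$ for $0\le j<m$, and, for all integers $j\ge 0$, $\gamma q^j\neq 1$, $\rho\ne q^{j+1}$ and $\beta\rho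 q^{j}/\gamma\ne q^{m}$. Then the bilateral series on the left and the ${}_4\phi_3$ series on the right converge absolutely, and $$\frac{(\beta)_m}{(q/\beta)_m}\sum_{n\in\mathbb{Z}}\frac{(1/\gamma,\ \rho,\ \gamma q^{1+m}/\beta\rho)_n}{(\gamma,\ q^{1+m}/\rho,\ \beta\rho/\gamma)_n}\,\frac{(\beta q^{m})_{2n}}{(q^{1+m}/\beta)_{2n}}\,(q/\beta)^{n}$$ $$=\frac{(q,\ q/\beta^2)_{\infty}}{(q/\beta,\ q/\beta)_{\infty}}\sum_{s=0}^{\lfloor m/2\rfloor}(\beta^3/q)^s\,\frac{(q/\gamma,\ \gamma q/\beta\rho,\ \rho q^{-m})_s}{(q,\ q/\rho,\ \beta\rho q^{-m}/\gamma)_s}\,\frac{1-\gamma q^{m-2s}}{1-\gamma}\,\frac{(\beta,\ \gamma^2)_{m-2s}}{(q,\ \gamma q)_{m-2s}}\,\frac{(q)_{m-s}}{(\gamma q)_{m-s}}$$ $$\qquad\times{}_4\phi_3\!\left[\begin{matrix}\beta/\gamma,\ \beta q^{m-2s},\ \rho\beta q^{-s},\ \gamma q^{1+m-s}/\rho\\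 \gamma q^{1+m-2s},\ \beta\rho q^{-s}/\gamma,\ q^{1+m-s}/\rho\end{matrix};q,\frac{q}{\beta^2}\right].$$ -/

import Mathlib

open scoped BigOperators

noncomputable section

/-- The infinite `q`-shifted factorial `(a; q)_∞ = ∏_{j ≥ 0} (1 - a q^j)`. -/
def qPochInf (a q : ℂ) : ℂ := ∏' j : ℕ, (1 - a * q ^ j)

/-- The `q`-shifted factorial `(a; q)_k` for an integer `k`:
`∏_{0 ≤ j < k} (1 - a q^j)` if `k ≥ 0`, and `1 / ∏_{1 ≤ j ≤ -k} (1 - a q^{-j})` if `k ≤ 0`.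
(At most one of the two products is nonempty.)  This is the value of `(a; q)_∞ / (a q^k; q)_∞`,
see `qPoch_eq_div`, with the removable singularities of that quotient removed. -/
def qPoch (a q : ℂ) (k : ℤ) : ℂ :=
  (∏ j ∈ Finset.range k.toNat, (1 - a * q ^ j)) /
    ∏ j ∈ Finset.range (-k).toNat, (1 - a / q ^ (j + 1))

/-- The compact notation `(a₁, …, aᵣ; q)_k = (a₁; q)_k ⋯ (aᵣ; q)_k`, `k` an integer. -/
def qPochs (as : List ℂ) (q : ℂ) (k : ℤ) : ℂ := (as.map fun a => qPoch a q k).prod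

/-- The compact notation `(a₁, …, aᵣ; q)_∞ = (a₁; q)_∞ ⋯ (aᵣ; q)_∞`. -/
def qPochsInf (as : List ℂ) (q : ℂ) : ℂ := (as.map fun a => qPochInf a q).prod

/-- The `k`-th term of the basic hypergeometric series with upper parameters `as`
and lower parameters `bs` (one fewer than the upper ones). -/
def qHypTerm (as bs : List ℂ) (q z : ℂ) (k : ℕ) : ℂ :=
  qPochs as q k / qPochs (q :: bs) q k * z ^ k

/-- The basic hypergeometric series `ₛφₛ₋₁[as; bs; q, z]`. -/
def qHyp (as bs : List ℂ) (q z : ℂ) : ℂ := ∑' k : ℕ, qHypTerm as bs q z k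

theorem qPochInf_multipliable (a : ℂ) {q : ℂ} (hq : ‖q‖ < 1) :
    Multipliable fun j : ℕ => 1 - a * q ^ j := by
  have h : Summable fun j : ℕ => ‖-(a * q ^ j)‖ := by
    simp only [norm_neg, norm_mul, norm_pow]
    exact (summable_geometric_of_lt_one (norm_nonneg q) hq).mul_left _
  simpa [sub_eq_add_neg] using multipliable_one_add_of_summable h

theorem qPochInf_split (a : ℂ) {q : ℂ} (hq : ‖q‖ < 1) (n : ℕ) :
    qPochInf a q = (∏ j ∈ Finset.range n, (1 - a * q ^ j)) * qPochInf (a * q ^ n) q := by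
  induction n with
  | zero => simp
  | succ n ih =>
    have hs : qPochInf (a * q ^ n) q = (1 - a * q ^ n) * qPochInf (a * q ^ (n + 1)) q := by
      unfold qPochInf
      have h := qPochInf_multipliable (a * q ^ (n + 1)) hq
      have e : (fun j : ℕ => 1 - a * q ^ n * q ^ (j + 1)) =
          fun j : ℕ => 1 - a * q ^ (n + 1) * q ^ j := by
        funext j; ring
      have h' : Multipliable fun j : ℕ => 1 - a * q ^ n * q ^ (j + 1) := by rw [e]; exact h
      have h2 := tprod_eq_zero_mul' (f := fun j : ℕ => 1 - a * q ^ n * q ^ j) h'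
      rw [e] at h2
      rw [h2, pow_zero, mul_one]
    rw [ih, hs, Finset.prod_range_succ]
    ring

/-- `(a; q)_k = (a; q)_∞ / (a q^k; q)_∞` whenever the denominator does not vanish. -/
theorem qPoch_eq_div (a : ℂ) {q : ℂ} (hq0 : q ≠ 0) (hq : ‖q‖ < 1) (k : ℤ)
    (hk : qPochInf (a * q ^ k) q ≠ 0) :
    qPoch a q k = qPochInf a q / qPochInf (a * q ^ k) q := by
  rcases Int.eq_nat_or_neg k with ⟨n, rfl | rfl⟩
  · rw [eq_div_iff hk]
    have h := qPochInf_split a hq n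
    simp only [zpow_natCast] at *
    rw [h]
    simp [qPoch]
  · have h := qPochInf_split (a * q ^ (-(n : ℤ))) hq n
    have e : a * q ^ (-(n : ℤ)) * q ^ n = a := by
      rw [zpow_neg, zpow_natCast, mul_assoc, inv_mul_cancel₀ (pow_ne_zero n hq0), mul_one]
    rw [e] at h
    have hP : ∏ j ∈ Finset.range n, (1 - a * q ^ (-(n : ℤ)) * q ^ j) =
        ∏ j ∈ Finset.range n, (1 - a / q ^ (j + 1)) := by
      rw [← Finset.prod_range_reflect]
      refine Finset.prod_congr rfl fun j hj => ?_
      have hj' : j < n := Finset.mem_range.mp hj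
      have hn : q ^ n = q ^ (n - 1 - j) * q ^ (j + 1) := by
        rw [← pow_add]; congr 1; omega
      have h1 : q ^ (n - 1 - j) ≠ 0 := pow_ne_zero _ hq0
      have h2 : q ^ (j + 1) ≠ 0 := pow_ne_zero _ hq0
      rw [zpow_neg, zpow_natCast, hn]
      field_simp
    rw [hP] at h
    have hpne : ∏ j ∈ Finset.range n, (1 - a / q ^ (j + 1)) ≠ 0 := by
      intro h0; rw [h0, zero_mul] at h; exact hk h
    rw [eq_div_iff hk, h]
    simp only [qPoch, neg_neg, Int.toNat_natCast]
    have h0 : (-(n : ℤ)).toNat = 0 := by omega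
    rw [h0, Finset.range_zero, Finset.prod_empty, ← mul_assoc, one_div,
      inv_mul_cancel₀ hpne, one_mul]

/-- The `n`-th term (`n` an integer) of the bilateral series
`∑ₙ (1/γ, ρ, γq^{1+m}/βρ)ₙ / (γ, q^{1+m}/ρ, βρ/γ)ₙ · (βq^m)₂ₙ / (q^{1+m}/β)₂ₙ · (q/β)^n`. -/
def lhsTerm (q β γ ρ : ℂ) (m : ℕ) (n : ℤ) : ℂ :=
  qPochs [1 / γ, ρ, γ * q ^ (1 + m) / (β * ρ)] q n /
      qPochs [γ, q ^ (1 + m) / ρ, β * ρ / γ] q n *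
    (qPoch (β * q ^ m) q (2 * n) / qPoch (q ^ (1 + m) / β) q (2 * n)) * (q / β) ^ n

/-- Upper parameters of the `₄φ₃` series with index `s`. -/
def upperParams (q β γ ρ : ℂ) (m s : ℕ) : List ℂ :=
  [β / γ, β * q ^ ((m : ℤ) - 2 * s), ρ * β * q ^ (-(s : ℤ)), γ * q ^ (1 + (m : ℤ) - s) / ρ]

/-- Lower parameters of the `₄φ₃` series with index `s`. -/
def lowerParams (q β γ ρ : ℂ) (m s : ℕ) : List ℂ :=
  [γ * q ^ (1 + (m : ℤ) - 2 * s), β * ρ * q ^ (-(s : ℤ)) / γ, q ^ (1 + (m : ℤ) - s) / ρ]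

/-- The explicit coefficient of the `₄φ₃` series with index `s`. -/
def rhsCoeff (q β γ ρ : ℂ) (m s : ℕ) : ℂ :=
  (β ^ 3 / q) ^ s *
    (qPochs [q / γ, γ * q / (β * ρ), ρ * q ^ (-(m : ℤ))] q s /
      qPochs [q, q / ρ, β * ρ * q ^ (-(m : ℤ)) / γ] q s) *
    ((1 - γ * q ^ ((m : ℤ) - 2 * s)) / (1 - γ)) *
    (qPochs [β, γ ^ 2] q ((m : ℤ) - 2 * s) / qPochs [q, γ * q] q ((m : ℤ) - 2 * s)) *
    (qPoch q q ((m : ℤ) - s) / qPoch (γ * q) q ((m : ℤ) - s))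

end

/-! Put z = q/β². By the q-Gauss sum, (β)_N/(q/β)_N is, up to the factor `gaussConst`, the
convolution ∑_k (β)_k (β)_{k+N} / ((q)_k (q)_{k+N}) z^k, for every integer N (`hasSum_convolution`).
With N = m + 2n this turns the bilateral series into an absolutely convergent double series over (n,
k) (`summable_doubleTerm`). Regrouped by L = n + k, the coefficient of z^L is a finite sum over 0 ≤
k ≤ M = m + 2L, because 1/(q)_{M-k} vanishes for k > M. On the right-hand side, term j of the series
with index s contributes to L = j - s. Equality of the two coefficients is `finite_identity`, and
`hasSum_bilateral` reassembles the series.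

The finite identity rests on two classical summations. The factors in k containing ρ, together with
(β)_k (β)_{M-k} / ((q)_k (q)_{M-k}), are the value of a terminating Jackson sum (`sum_jacksonTerm`)
with R = ρq^L. It expands them in the kernels (γ)_{k-j} (γ)_{M-k-j} / ((q)_{k-j} (q)_{M-k-j}); its
formal limit R → 0 is Rogers' connection formula for the continuous q-ultraspherical polynomials.
After the two sums are exchanged, the kernel is summed over k against the remaining factor γ^N
(q/γ)_N/(γq)_N, N = k - L, by q-Saalschütz (`sum_ultrasphericalWeight_mul_jacksonTerm`). The result
vanishes for j < L, so s = j - L runs from 0 to ⌊m/2⌋, and `rhsCoeff_mul_qHypTerm` recognises the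
terms of the right-hand side.

The rearrangement of factorials with negative index needs β, γ, ρ and βρ/γ to avoid the powers of q.
This restriction is removed by continuity, scaling β, γ, ρ by a common u → 1.

Each of the three summations is proved by a telescoping certificate: a first-order recurrence
operator applied to the summand is a difference G(j+1) - G(j) in the summation index. -/

/-! ### Shifted factorials of integer index: recurrences and reflection. -/

/-- `a` avoids all integral powers of `q`, so that no `q`-shifted factorial of `a` degenerates. -/
def QGeneric (a q : ℂ) : Prop := ∀ k : ℤ, a * q ^ k ≠ 1

theorem qPoch_zero (a q : ℂ) : qPoch a q 0 = 1 := by simp [qPoch]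

theorem qPoch_natCast (a q : ℂ) (n : ℕ) :
    qPoch a q n = ∏ j ∈ Finset.range n, (1 - a * q ^ j) := by
  simp [qPoch]

theorem qPoch_neg_natCast (a q : ℂ) (n : ℕ) :
    qPoch a q (-(n : ℤ)) = (∏ j ∈ Finset.range n, (1 - a / q ^ (j + 1)))⁻¹ := by
  simp [qPoch]

/-- For n < 0 the factor 1 - aq^n is cancelled from a denominator, so it must be nonzero; for n ≥ 0
it is simply appended. -/
theorem qPoch_add_one (a q : ℂ) (n : ℤ) (h : 0 ≤ n ∨ a * q ^ n ≠ 1) :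
    qPoch a q (n + 1) = qPoch a q n * (1 - a * q ^ n) := by
  rcases le_or_gt 0 n with hn | hn
  · lift n to ℕ using hn
    have := qPoch_natCast a q (n + 1)
    push_cast at this
    rw [this, qPoch_natCast, Finset.prod_range_succ, zpow_natCast]
  · have h1 : a * q ^ n ≠ 1 := by
      rcases h with h | h
      · omega
      · exact h
    obtain ⟨k, rfl⟩ : ∃ k : ℕ, n = -((k + 1 : ℕ) : ℤ) := ⟨(-n - 1).toNat, by omega⟩
    have e : -((k + 1 : ℕ) : ℤ) + 1 = -(k : ℤ) := by push_cast; ring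
    rw [e, qPoch_neg_natCast, qPoch_neg_natCast, Finset.prod_range_succ, mul_inv, mul_assoc]
    have e2 : a * q ^ (-((k + 1 : ℕ) : ℤ)) = a / q ^ (k + 1) := by
      rw [zpow_neg, zpow_natCast, div_eq_mul_inv]
    rw [e2] at h1 ⊢
    rw [inv_mul_cancel₀ (sub_ne_zero.mpr (Ne.symm h1)), mul_one]

/-- Reciprocals are products at negative index, so the sign on which a condition is needed is
opposite to that in `qPoch_add_one`. -/
theorem inv_qPoch_eq (a q : ℂ) (n : ℤ) (h : n < 0 ∨ a * q ^ n ≠ 1) :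
    (qPoch a q n)⁻¹ = (1 - a * q ^ n) * (qPoch a q (n + 1))⁻¹ := by
  rcases le_or_gt 0 n with hn | hn
  · have h1 : a * q ^ n ≠ 1 := by
      rcases h with h | h
      · omega
      · exact h
    rw [qPoch_add_one a q n (Or.inl hn), mul_inv, mul_comm, mul_assoc,
      inv_mul_cancel₀ (sub_ne_zero.mpr (Ne.symm h1)), mul_one]
  · obtain ⟨k, rfl⟩ : ∃ k : ℕ, n = -((k + 1 : ℕ) : ℤ) := ⟨(-n - 1).toNat, by omega⟩
    have e : -((k + 1 : ℕ) : ℤ) + 1 = -(k : ℤ) := by push_cast; ring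
    rw [e, qPoch_neg_natCast, qPoch_neg_natCast, Finset.prod_range_succ, inv_inv, inv_inv,
      mul_comm, zpow_neg, zpow_natCast, div_eq_mul_inv]

theorem zpow_ne_one_of_norm_lt_one {q : ℂ} (hq0 : q ≠ 0) (hq : ‖q‖ < 1) {n : ℤ} (hn : n ≠ 0) :
    q ^ n ≠ 1 := by
  intro h
  have h1 : ‖q‖ ^ n = 1 := by rw [← norm_zpow, h, norm_one]
  have h0 : 0 < ‖q‖ := norm_pos_iff.mpr hq0
  exact hn ((zpow_eq_one_iff_right₀ h0.le hq.ne).mp h1)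

/-- The recurrence for `1 / (q; q)_n`, valid for every integer `n`. -/
theorem inv_qPoch_self {q : ℂ} (hq0 : q ≠ 0) (hq : ‖q‖ < 1) (n : ℤ) :
    (qPoch q q n)⁻¹ = (1 - q ^ (n + 1)) * (qPoch q q (n + 1))⁻¹ := by
  have e : q * q ^ n = q ^ (n + 1) := by rw [zpow_add_one₀ hq0, mul_comm]
  rw [inv_qPoch_eq q q n, e]
  rcases lt_or_ge n 0 with h | h
  · exact Or.inl h
  · exact Or.inr (by rw [e]; exact zpow_ne_one_of_norm_lt_one hq0 hq (by omega))

/-- The value 0 at a pole comes from division by zero; its inverse 0 is the correct value of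
1/(q)_n. This is what truncates the sums below. -/
theorem qPoch_self_of_neg {q : ℂ} (hq0 : q ≠ 0) {n : ℤ} (hn : n < 0) : qPoch q q n = 0 := by
  obtain ⟨k, rfl⟩ : ∃ k : ℕ, n = -((k + 1 : ℕ) : ℤ) := ⟨(-n - 1).toNat, by omega⟩
  rw [qPoch_neg_natCast, Finset.prod_range_succ', inv_eq_zero]
  simp [hq0]

theorem qPoch_natCast_ne_zero {a q : ℂ} (n : ℕ) (h : ∀ j : ℕ, j < n → a * q ^ j ≠ 1) :
    qPoch a q n ≠ 0 := by
  rw [qPoch_natCast, Finset.prod_ne_zero_iff]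
  intro j hj
  exact sub_ne_zero.mpr (Ne.symm (h j (Finset.mem_range.mp hj)))

theorem qPoch_self_natCast_ne_zero {q : ℂ} (hq0 : q ≠ 0) (hq : ‖q‖ < 1) (n : ℕ) :
    qPoch q q n ≠ 0 := by
  refine qPoch_natCast_ne_zero n fun j _ => ?_
  have := zpow_ne_one_of_norm_lt_one hq0 hq (n := (j : ℤ) + 1) (by omega)
  rwa [zpow_add_one₀ hq0, zpow_natCast, mul_comm] at this

namespace QGeneric

variable {a b q : ℂ}

theorem sub_ne_zero (h : QGeneric a q) (k : ℤ) : 1 - a * q ^ k ≠ 0 :=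
  _root_.sub_ne_zero.mpr (Ne.symm (h k))

theorem qPoch_ne_zero (h : QGeneric a q) (hq0 : q ≠ 0) (n : ℤ) : qPoch a q n ≠ 0 := by
  unfold qPoch
  refine div_ne_zero ?_ ?_ <;> rw [Finset.prod_ne_zero_iff] <;> intro j _
  · have := h.sub_ne_zero j
    rwa [zpow_natCast] at this
  · have := h.sub_ne_zero (-((j + 1 : ℕ) : ℤ))
    rwa [zpow_neg, zpow_natCast, ← div_eq_mul_inv] at this

theorem mul_zpow (h : QGeneric a q) (hq0 : q ≠ 0) (n : ℤ) : QGeneric (a * q ^ n) q := by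
  intro k
  rw [mul_assoc, ← zpow_add₀ hq0]
  exact h _

theorem inv (h : QGeneric a q) : QGeneric a⁻¹ q := by
  intro k hk
  apply h (-k)
  have := congrArg Inv.inv hk
  rwa [mul_inv, inv_inv, inv_one, ← zpow_neg] at this

theorem qPoch_add_one (h : QGeneric a q) (n : ℤ) :
    qPoch a q (n + 1) = qPoch a q n * (1 - a * q ^ n) :=
  _root_.qPoch_add_one a q n (Or.inr (h n))

theorem qPoch_add (h : QGeneric a q) (hq0 : q ≠ 0) (n k : ℤ) :
    qPoch a q (n + k) = qPoch a q n * qPoch (a * q ^ n) q k := by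
  have h' := h.mul_zpow hq0 n
  -- An equivalence serves both the upward and the downward half of the induction over ℤ.
  have step : ∀ i : ℤ, (qPoch a q (n + i) = qPoch a q n * qPoch (a * q ^ n) q i ↔
      qPoch a q (n + (i + 1)) = qPoch a q n * qPoch (a * q ^ n) q (i + 1)) := by
    intro i
    rw [h'.qPoch_add_one, ← add_assoc, h.qPoch_add_one, mul_assoc a, ← zpow_add₀ hq0, ← mul_assoc]
    exact (mul_left_inj' (h.sub_ne_zero _)).symm
  induction k using Int.induction_on with
  | zero => simp [qPoch_zero]
  | succ i ih => exact (step _).mp ih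
  | pred i ih =>
    refine (step _).mpr ?_
    rw [sub_add_cancel]
    exact ih

/-- `(x; q)_{-s} (q/x; q)_s x^s` does not depend on `x`. -/
theorem reflect {x y : ℂ} (hx : QGeneric x q) (hy : QGeneric y q) (hq0 : q ≠ 0) (hx0 : x ≠ 0)
    (hy0 : y ≠ 0) (s : ℤ) :
    qPoch x q (-s) * qPoch (q / x) q s * x ^ s = qPoch y q (-s) * qPoch (q / y) q s * y ^ s := by
  -- Each step multiplies by -q^{i+1}, whatever w is. Comparing two arguments avoids the explicit
  -- value (-1)^s q^{s(s+1)/2}.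
  have key : ∀ {w : ℂ}, QGeneric w q → w ≠ 0 → ∀ i : ℤ,
      qPoch w q (-(i + 1)) * qPoch (q / w) q (i + 1) * w ^ (i + 1) =
        -q ^ (i + 1) * (qPoch w q (-i) * qPoch (q / w) q i * w ^ i) := by
    intro w hw hw0 i
    have hw' : QGeneric (q / w) q := by
      have := hw.inv.mul_zpow hq0 1
      rwa [zpow_one, mul_comm, ← div_eq_mul_inv] at this
    have e1 := hw.qPoch_add_one (-(i + 1))
    rw [show -(i + 1) + 1 = -i by ring] at e1
    have hne : q ^ i ≠ 0 := zpow_ne_zero _ hq0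
    rw [e1, hw'.qPoch_add_one, zpow_add_one₀ hw0, zpow_neg, zpow_add_one₀ hq0]
    field_simp
    ring
  have step : ∀ i : ℤ, (qPoch x q (-i) * qPoch (q / x) q i * x ^ i =
      qPoch y q (-i) * qPoch (q / y) q i * y ^ i ↔
      qPoch x q (-(i + 1)) * qPoch (q / x) q (i + 1) * x ^ (i + 1) =
      qPoch y q (-(i + 1)) * qPoch (q / y) q (i + 1) * y ^ (i + 1)) := by
    intro i
    rw [key hx hx0, key hy hy0]
    exact (mul_right_inj' (neg_ne_zero.mpr (zpow_ne_zero _ hq0))).symm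
  induction s using Int.induction_on with
  | zero => simp [qPoch_zero]
  | succ i ih => exact (step _).mp ih
  | pred i ih =>
    refine (step _).mpr ?_
    rw [sub_add_cancel]
    exact ih

end QGeneric

/-! ### Jackson's terminating sum by a telescoping certificate. -/

/-- The coefficients in `sum_jacksonCoeff`. -/
noncomputable def jacksonCoeff (q β γ R : ℂ) (M : ℤ) (j : ℕ) : ℂ :=
  (β * γ) ^ j * (1 - γ * q ^ (M - 2 * j)) *
    (qPoch (β / γ) q j * qPoch (q / (R * β)) q j * qPoch (R / (γ * q ^ M)) q j *
      qPoch β q (M - j)) /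
    (qPoch q q j * qPoch (q / R) q j * qPoch (β * R / (γ * q ^ M)) q j * qPoch γ q (M - j + 1))

theorem qPoch_natCast_succ (a q : ℂ) (n : ℕ) :
    qPoch a q ((n + 1 : ℕ) : ℤ) = qPoch a q n * (1 - a * q ^ n) := by
  rw [Nat.cast_succ, qPoch_add_one a q n (Or.inl (Int.natCast_nonneg n)), zpow_natCast]

section Jackson

variable {q β γ R : ℂ}

/-- This is the certificate equation with y = q^j, Q = q^k, Z = q^M, divided by the factorials
common to all its terms and multiplied by the one denominator left, 1 - γZ/y². -/
theorem jackson_certificate_identity (y Q Z : ℂ) (hq0 : q ≠ 0) (hβ : β ≠ 0) (hγ : γ ≠ 0)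
    (hR : R ≠ 0) (hy : y ≠ 0) (hQ : Q ≠ 0) (hZ : Z ≠ 0) :
    ((1 - q * Q / R) * (1 - β * R * Q / (γ * Z)) * (1 - β * Z / (Q * q)) * (1 - q * Q) *
        ((1 - γ * Q / y) * (1 - Z / (Q * y))) -
      β / γ * (1 - q * γ * Q / (β * R)) * (1 - R * Q / Z) * (1 - β * Q) * (1 - Z / Q) *
        ((1 - q * Q / y) * (1 - γ * Z / (Q * q * y)))) * (1 - γ * Z / y ^ 2) =
    -(Q ^ 2 - Z / q) / y ^ 2 * (β * γ) * ((1 - β * y / γ) * (1 - q * y / (R * β)) *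
        (1 - R * y / (γ * Z)) * (1 - γ * Z / y) * (1 - q * Q / y) * (1 - Z / (Q * y))) -
      -(q ^ 2 * Q ^ 2 - q * Z) / y ^ 2 * ((1 - y) * (1 - y / R) * (1 - β * R * y / (γ * Z * q)) *
        (1 - β * Z / y) * (1 - γ * Q / y) * (1 - γ * Z / (Q * q * y))) := by
  field_simp
  ring

theorem QGeneric.one_sub_ne_zero {a q : ℂ} (h : QGeneric a q) {x : ℂ} (k : ℤ) (hx : x = a * q ^ k) :
    1 - x ≠ 0 := by
  rw [hx]
  exact h.sub_ne_zero k

theorem one_sub_zpow_ne_zero (hq0 : q ≠ 0) (hq : ‖q‖ < 1) {n : ℤ} (hn : n ≠ 0) :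
    1 - q ^ n ≠ 0 :=
  sub_ne_zero.mpr (zpow_ne_one_of_norm_lt_one hq0 hq hn).symm

theorem jacksonCoeff_succ_aux {P a₁ a₂ a₃ a₄ e₁ e₂ e₃ A₁ A₂ A₃ A₄ N₁ N₂ N₃ N₄ N₅ N₆ N₇ w : ℂ}
    (h₁ : A₁ ≠ 0) (h₂ : A₂ ≠ 0) (h₃ : A₃ ≠ 0) (h₄ : A₄ ≠ 0) (n₁ : N₁ ≠ 0) (n₂ : N₂ ≠ 0)
    (n₃ : N₃ ≠ 0) (n₅ : N₅ ≠ 0) :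
    P * w * N₇ * (a₁ * e₁ * (a₂ * e₂) * (a₃ * e₃) * a₄) / (A₁ * N₁ * (A₂ * N₂) * (A₃ * N₃) * A₄) *
        (N₆ * N₁ * N₂ * N₃ * N₄) =
      P * N₆ * (a₁ * a₂ * a₃ * (a₄ * N₄)) / (A₁ * A₂ * A₃ * (A₄ * N₅)) *
        (w * N₇ * e₁ * e₂ * e₃ * N₅) := by
  rw [div_mul_eq_mul_div, div_mul_eq_mul_div, div_eq_div_iff (by simp [*]) (by simp [*])]
  ring

theorem jacksonCoeff_succ (hq0 : q ≠ 0) (hq : ‖q‖ < 1)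
    (Gβ : QGeneric β q) (Gγ : QGeneric γ q) (GR : QGeneric R q) (Gx : QGeneric (β * R / γ) q)
    (M : ℤ) (j : ℕ) (y Z : ℂ) (hy : y = q ^ j) (hZ : Z = q ^ M) :
    jacksonCoeff q β γ R M (j + 1) * ((1 - γ * Z / y ^ 2) * (1 - q * y) * (1 - q * y / R) *
        (1 - β * R * y / (γ * Z)) * (1 - β * Z / (q * y))) =
      jacksonCoeff q β γ R M j * (β * γ * (1 - γ * Z / (q ^ 2 * y ^ 2)) * (1 - β * y / γ) *
        (1 - q * y / (R * β)) * (1 - R * y / (γ * Z)) * (1 - γ * Z / y)) := by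
  have hy0 : y ≠ 0 := hy ▸ pow_ne_zero _ hq0
  have hZ0 : Z ≠ 0 := hZ ▸ zpow_ne_zero _ hq0
  have a1 := qPoch_natCast_succ (β / γ) q j
  have a2 := qPoch_natCast_succ (q / (R * β)) q j
  have a3 := qPoch_natCast_succ (R / (γ * Z)) q j
  have b1 := qPoch_natCast_succ q q j
  have b2 := qPoch_natCast_succ (q / R) q j
  have b3 := qPoch_natCast_succ (β * R / (γ * Z)) q j
  have a4 := Gβ.qPoch_add_one (M - (j + 1))
  have b4 := Gγ.qPoch_add_one (M - j)
  have z1 : q ^ (M - (j + 1) : ℤ) = Z / (q * y) := by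
    rw [zpow_sub₀ hq0, zpow_add_one₀ hq0, zpow_natCast, ← hy, ← hZ, mul_comm]
  have z2 : q ^ (M - j : ℤ) = Z / y := by
    rw [zpow_sub₀ hq0, zpow_natCast, ← hy, ← hZ]
  have z3 : q ^ (M - 2 * (j : ℤ)) = Z / y ^ 2 := by
    rw [zpow_sub₀ hq0, mul_comm, zpow_mul, zpow_natCast, ← hy, ← hZ]; rfl
  have z4 : q ^ (M - 2 * ((j + 1 : ℕ) : ℤ)) = Z / (q ^ 2 * y ^ 2) := by
    rw [show M - 2 * ((j + 1 : ℕ) : ℤ) = M - 2 * (j : ℤ) - 2 by push_cast; ring,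
      zpow_sub₀ hq0, z3, div_div, mul_comm]; rfl
  rw [← hy] at a1 a2 a3 b1 b2 b3
  rw [z1, sub_add_eq_sub_sub, sub_add_cancel] at a4
  rw [z2] at b4
  have n1 : (1 - q * y) ≠ 0 := by
    have := one_sub_zpow_ne_zero (n := (j : ℤ) + 1) hq0 hq (by omega)
    rwa [zpow_add_one₀ hq0, zpow_natCast, ← hy, mul_comm] at this
  have hγR := Gx.mul_zpow hq0 (-M)
  have ex : β * R / γ * q ^ (-M) = β * R / (γ * Z) := by
    rw [zpow_neg, hZ, div_mul_eq_mul_div, ← div_eq_mul_inv, div_div, mul_comm (q ^ M)]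
  rw [ex] at hγR
  have hqR : QGeneric (q / R) q := by
    have := GR.inv.mul_zpow hq0 1
    rwa [zpow_one, mul_comm, ← div_eq_mul_inv] at this
  have n2 : (1 - q * y / R) ≠ 0 := hqR.one_sub_ne_zero j (by rw [zpow_natCast, ← hy]; ring)
  have n3 : (1 - β * R * y / (γ * Z)) ≠ 0 :=
    hγR.one_sub_ne_zero j (by rw [zpow_natCast, ← hy]; ring)
  have n4 : 1 - β * Z / (q * y) ≠ 0 := Gβ.one_sub_ne_zero _ (by rw [z1]; ring)
  have n5 : 1 - γ * Z / y ≠ 0 := Gγ.one_sub_ne_zero _ (by rw [z2]; ring)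
  have c1 := qPoch_self_natCast_ne_zero hq0 hq j
  have c2 := hqR.qPoch_ne_zero hq0 j
  have c3 := hγR.qPoch_ne_zero hq0 j
  have c4 := Gγ.qPoch_ne_zero hq0 (M - j)
  unfold jacksonCoeff
  rw [← hZ, a1, a2, a3, b1, b2, b3, z3, z4,
    show M - ((j + 1 : ℕ) : ℤ) + 1 = M - j by push_cast; ring,
    show M - ((j + 1 : ℕ) : ℤ) = M - j - 1 by push_cast; ring, b4, a4, pow_succ (β * γ)]
  rw [show β / γ * y = β * y / γ by ring, show q / (R * β) * y = q * y / (R * β) by ring,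
    show R / (γ * Z) * y = R * y / (γ * Z) by ring, show q / R * y = q * y / R by ring,
    show β * R / (γ * Z) * y = β * R * y / (γ * Z) by ring,
    show γ * (Z / y) = γ * Z / y by ring, show β * (Z / (q * y)) = β * Z / (q * y) by ring,
    show γ * (Z / y ^ 2) = γ * Z / y ^ 2 by ring,
    show γ * (Z / (q ^ 2 * y ^ 2)) = γ * Z / (q ^ 2 * y ^ 2) by ring]
  exact jacksonCoeff_succ_aux c1 c2 c3 c4 n1 n2 n3 n5

end Jackson

section Jackson

variable {q β γ R : ℂ}

/-- The common factor of two neighbouring summands in `sum_jacksonCoeff`. -/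
noncomputable def jacksonCore (q γ : ℂ) (M k : ℤ) (j : ℕ) : ℂ :=
  qPoch γ q (k - j) * qPoch γ q (M - k - 1 - j) *
    (qPoch q q (k + 1 - j))⁻¹ * (qPoch q q (M - k - j))⁻¹

/-- The summand of `sum_jacksonCoeff`. -/
noncomputable def jacksonTerm (q β γ R : ℂ) (M k : ℤ) (j : ℕ) : ℂ :=
  jacksonCoeff q β γ R M j * (qPoch γ q (k - j) * qPoch γ q (M - k - j) *
    (qPoch q q (k - j))⁻¹ * (qPoch q q (M - k - j))⁻¹)

/-- The antidifference certifying `sum_jacksonCoeff`. -/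
noncomputable def jacksonCert (q β γ R : ℂ) (M k : ℤ) (j : ℕ) : ℂ :=
  -(q ^ 2 * (q ^ k) ^ 2 - q * q ^ M) / (q ^ j) ^ 2 *
    ((1 - q ^ j) * (1 - q ^ j / R) * (1 - β * R * q ^ j / (γ * q ^ M * q)) *
        (1 - β * q ^ M / q ^ j) * (1 - γ * q ^ k / q ^ j) *
        (1 - γ * q ^ M / (q ^ k * q * q ^ j))) / (1 - γ * q ^ M / (q ^ j) ^ 2) *
    (jacksonCoeff q β γ R M j * jacksonCore q γ M k j)

/-- `jacksonCore` is chosen so that the summands at k and at k + 1 are both polynomial multiples of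
it in γ; the certificate then becomes a rational identity. -/
theorem jacksonTerm_eq (hq0 : q ≠ 0) (hq : ‖q‖ < 1) (Gγ : QGeneric γ q) (M k : ℤ) (j : ℕ) :
    jacksonTerm q β γ R M k j = (1 - q * q ^ k / q ^ j) *
      (1 - γ * q ^ M / (q ^ k * q * q ^ j)) * (jacksonCoeff q β γ R M j * jacksonCore q γ M k j) := by
  have h1 := inv_qPoch_self hq0 hq (k - j)
  have h2 := Gγ.qPoch_add_one (M - k - 1 - j)
  rw [show M - k - 1 - j + 1 = M - k - (j : ℤ) by ring] at h2
  rw [show k - j + 1 = k + 1 - (j : ℤ) by ring] at h1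
  have e1 : q ^ (k + 1 - j : ℤ) = q * q ^ k / q ^ j := by
    rw [zpow_sub₀ hq0, zpow_add_one₀ hq0, zpow_natCast, mul_comm q]
  have e2 : q ^ (M - k - 1 - j : ℤ) = q ^ M / (q ^ k * q * q ^ j) := by
    rw [zpow_sub₀ hq0, zpow_sub₀ hq0, zpow_sub₀ hq0, zpow_natCast, zpow_one, div_div, div_div]
    ring
  unfold jacksonTerm jacksonCore
  rw [h1, h2, e1, e2]
  ring

theorem jacksonTerm_add_one (hq0 : q ≠ 0) (hq : ‖q‖ < 1) (Gγ : QGeneric γ q) (M k : ℤ) (j : ℕ) :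
    jacksonTerm q β γ R M (k + 1) j = (1 - γ * q ^ k / q ^ j) *
      (1 - q ^ M / (q ^ k * q ^ j)) * (jacksonCoeff q β γ R M j * jacksonCore q γ M k j) := by
  have h1 := inv_qPoch_self hq0 hq (M - k - 1 - j)
  have h2 := Gγ.qPoch_add_one (k - j)
  rw [show M - k - 1 - j + 1 = M - k - (j : ℤ) by ring] at h1
  rw [show k - j + 1 = k + 1 - (j : ℤ) by ring] at h2
  have e1 : q ^ (k - j : ℤ) = q ^ k / q ^ j := by
    rw [zpow_sub₀ hq0, zpow_natCast]
  have e2 : q ^ (M - k - j : ℤ) = q ^ M / (q ^ k * q ^ j) := by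
    rw [zpow_sub₀ hq0, zpow_sub₀ hq0, zpow_natCast, div_div]
  unfold jacksonTerm jacksonCore
  rw [show M - (k + 1) - (j : ℤ) = M - k - 1 - j by ring, h1, h2, e1, e2]
  ring

theorem jacksonCore_succ (hq0 : q ≠ 0) (hq : ‖q‖ < 1) (Gγ : QGeneric γ q) (M k : ℤ) (j : ℕ) :
    jacksonCore q γ M k (j + 1) *
      ((1 - γ * q ^ k / (q * q ^ j)) * (1 - γ * q ^ M / (q ^ k * q ^ 2 * q ^ j))) =
    (1 - q * q ^ k / q ^ j) * (1 - q ^ M / (q ^ k * q ^ j)) * jacksonCore q γ M k j := by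
  have h1 := inv_qPoch_self hq0 hq (k - j)
  have h2 := inv_qPoch_self hq0 hq (M - k - 1 - j)
  have h3 := Gγ.qPoch_add_one (k - 1 - j)
  have h4 := Gγ.qPoch_add_one (M - k - 1 - 1 - j)
  rw [show k - j + 1 = k + 1 - (j : ℤ) by ring] at h1
  rw [show M - k - 1 - j + 1 = M - k - (j : ℤ) by ring] at h2
  rw [show k - 1 - j + 1 = k - (j : ℤ) by ring] at h3
  rw [show M - k - 1 - 1 - j + 1 = M - k - 1 - (j : ℤ) by ring] at h4
  have e1 : q ^ (k + 1 - j : ℤ) = q * q ^ k / q ^ j := by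
    rw [zpow_sub₀ hq0, zpow_add_one₀ hq0, zpow_natCast, mul_comm q]
  have e2 : q ^ (M - k - j : ℤ) = q ^ M / (q ^ k * q ^ j) := by
    rw [zpow_sub₀ hq0, zpow_sub₀ hq0, zpow_natCast, div_div]
  have e3 : q ^ (k - 1 - j : ℤ) = q ^ k / (q * q ^ j) := by
    rw [zpow_sub₀ hq0, zpow_sub₀ hq0, zpow_natCast, zpow_one, div_div]
  have e4 : q ^ (M - k - 1 - 1 - j : ℤ) = q ^ M / (q ^ k * q ^ 2 * q ^ j) := by
    rw [zpow_sub₀ hq0, zpow_sub₀ hq0, zpow_sub₀ hq0, zpow_sub₀ hq0, zpow_natCast, zpow_one,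
      div_div, div_div, div_div]
    ring
  unfold jacksonCore
  rw [show k - ((j + 1 : ℕ) : ℤ) = k - 1 - j by push_cast; ring,
    show M - k - 1 - ((j + 1 : ℕ) : ℤ) = M - k - 1 - 1 - j by push_cast; ring,
    show k + 1 - ((j + 1 : ℕ) : ℤ) = k - j by push_cast; ring,
    show M - k - ((j + 1 : ℕ) : ℤ) = M - k - 1 - j by push_cast; ring, h1, h2, h3, h4, e1, e2, e3,
    e4]
  ring

theorem jacksonCert_succ_aux {K a b c d e f E W V D : ℂ} (hE : E ≠ 0) (hD : D ≠ 0) :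
    K * (a * b * c * d * e * f) / E * (W * V) =
      K / (E * D) * (W * (D * a * b * c * d)) * (V * (e * f)) := by
  rw [div_mul_eq_mul_div, div_mul_eq_mul_div, div_mul_eq_mul_div,
    div_eq_div_iff hE (mul_ne_zero hE hD)]
  ring

theorem jacksonCert_succ_aux' {K a b c d e f x E W V D : ℂ} (hE : E ≠ 0) (hD : D ≠ 0) :
    K / (E * D) * (W * (x * E * a * b * c * d)) * (e * f * V) =
      K * x * (a * b * c * d * e * f) / D * (W * V) := by
  rw [div_mul_eq_mul_div, div_mul_eq_mul_div, div_mul_eq_mul_div,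
    div_eq_div_iff (mul_ne_zero hE hD) hD]
  ring

/-- Brings G(j+1) to the same common factor as G(j). The denominator of the certificate at j + 1
cancels the very-well-poised factor of the next coefficient, leaving only the denominator at j. -/
theorem jacksonCert_succ (hq0 : q ≠ 0) (hq : ‖q‖ < 1)
    (Gβ : QGeneric β q) (Gγ : QGeneric γ q) (GR : QGeneric R q) (Gx : QGeneric (β * R / γ) q)
    (M k : ℤ) (j : ℕ) (y Q Z : ℂ) (hy : y = q ^ j) (hQ : Q = q ^ k) (hZ : Z = q ^ M) :
    jacksonCert q β γ R M k (j + 1) =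
      -(Q ^ 2 - Z / q) / y ^ 2 * (β * γ) * ((1 - β * y / γ) * (1 - q * y / (R * β)) *
        (1 - R * y / (γ * Z)) * (1 - γ * Z / y) * (1 - q * Q / y) * (1 - Z / (Q * y))) /
        (1 - γ * Z / y ^ 2) * (jacksonCoeff q β γ R M j * jacksonCore q γ M k j) := by
  have hy0 : y ≠ 0 := hy ▸ pow_ne_zero _ hq0
  have hQ0 : Q ≠ 0 := hQ ▸ zpow_ne_zero _ hq0
  have r1 := jacksonCoeff_succ hq0 hq Gβ Gγ GR Gx M j y Z hy hZ
  have r2 := jacksonCore_succ hq0 hq Gγ M k j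
  have d1 : 1 - γ * Z / y ^ 2 ≠ 0 := Gγ.one_sub_ne_zero (M - 2 * (j : ℤ)) (by
    rw [zpow_sub₀ hq0, mul_comm 2, zpow_mul, zpow_natCast, ← hy, ← hZ, mul_div_assoc]; rfl)
  have d2 : 1 - γ * Z / (q ^ 2 * y ^ 2) ≠ 0 := Gγ.one_sub_ne_zero (M - 2 * ((j : ℤ) + 1)) (by
    rw [zpow_sub₀ hq0, mul_comm 2, zpow_mul, zpow_add_one₀ hq0, zpow_natCast, ← hy, ← hZ,
      mul_div_assoc, ← mul_pow, mul_comm q]; rfl)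
  have d3 : 1 - γ * Q / (q * y) ≠ 0 := Gγ.one_sub_ne_zero (k - 1 - j) (by
    rw [zpow_sub₀ hq0, zpow_sub₀ hq0, zpow_natCast, zpow_one, div_div, hQ, hy]; ring)
  have d4 : 1 - γ * Z / (Q * q ^ 2 * y) ≠ 0 := Gγ.one_sub_ne_zero (M - k - 1 - 1 - j) (by
    rw [zpow_sub₀ hq0, zpow_sub₀ hq0, zpow_sub₀ hq0, zpow_sub₀ hq0, zpow_natCast, zpow_one,
      div_div, div_div, div_div, hQ, hy, hZ]
    ring)
  unfold jacksonCert
  have hs : q ^ (j + 1) = q * y := by rw [pow_succ, ← hy, mul_comm]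
  rw [← hy, ← hQ, ← hZ] at r2
  rw [hs, ← hQ, ← hZ]
  rw [show β * R * (q * y) / (γ * Z * q) = β * R * y / (γ * Z) by field_simp,
    show γ * Z / (Q * q * (q * y)) = γ * Z / (Q * q ^ 2 * y) by ring_nf, mul_pow q y 2]
  calc _ = -(q ^ 2 * Q ^ 2 - q * Z) / (q ^ 2 * y ^ 2) / (1 - γ * Z / (q ^ 2 * y ^ 2)) /
          (1 - γ * Z / y ^ 2) *
        (jacksonCoeff q β γ R M (j + 1) * ((1 - γ * Z / y ^ 2) * (1 - q * y) * (1 - q * y / R) *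
          (1 - β * R * y / (γ * Z)) * (1 - β * Z / (q * y)))) *
        (jacksonCore q γ M k (j + 1) *
          ((1 - γ * Q / (q * y)) * (1 - γ * Z / (Q * q ^ 2 * y)))) := by
        rw [div_div _ (1 - γ * Z / (q ^ 2 * y ^ 2)) (1 - γ * Z / y ^ 2)]
        exact jacksonCert_succ_aux d2 d1
    _ = _ := by
        rw [r1, r2]
        have e : -(q ^ 2 * Q ^ 2 - q * Z) / (q ^ 2 * y ^ 2) = -(Q ^ 2 - Z / q) / y ^ 2 := by
          field_simp
        rw [e, div_div]
        exact jacksonCert_succ_aux' d2 d1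

end Jackson

section Jackson

variable {q β γ R : ℂ}

theorem jackson_certificate (hq0 : q ≠ 0) (hq : ‖q‖ < 1) (hβ : β ≠ 0) (hγ : γ ≠ 0) (hR : R ≠ 0)
    (Gβ : QGeneric β q) (Gγ : QGeneric γ q) (GR : QGeneric R q) (Gx : QGeneric (β * R / γ) q)
    (M k : ℤ) (j : ℕ) (Q Z : ℂ) (hQ : Q = q ^ k) (hZ : Z = q ^ M) :
    (1 - q * Q / R) * (1 - β * R * Q / (γ * Z)) * (1 - β * Z / (Q * q)) * (1 - q * Q) *
        jacksonTerm q β γ R M (k + 1) j -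
      β / γ * (1 - q * γ * Q / (β * R)) * (1 - R * Q / Z) * (1 - β * Q) * (1 - Z / Q) *
        jacksonTerm q β γ R M k j =
    jacksonCert q β γ R M k (j + 1) - jacksonCert q β γ R M k j := by
  have hy0 : q ^ j ≠ 0 := pow_ne_zero _ hq0
  have hQ0 : Q ≠ 0 := hQ ▸ zpow_ne_zero _ hq0
  have hZ0 : Z ≠ 0 := hZ ▸ zpow_ne_zero _ hq0
  have d1 : 1 - γ * Z / (q ^ j) ^ 2 ≠ 0 := Gγ.one_sub_ne_zero (M - 2 * (j : ℤ)) (by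
    rw [zpow_sub₀ hq0, mul_comm 2, zpow_mul, zpow_natCast, ← hZ, mul_div_assoc]; rfl)
  have id := jackson_certificate_identity (β := β) (γ := γ) (R := R) (q ^ j) Q Z hq0 hβ hγ hR hy0
    hQ0 hZ0
  rw [← eq_div_iff d1] at id
  rw [jacksonCert_succ hq0 hq Gβ Gγ GR Gx M k j (q ^ j) Q Z rfl hQ hZ,
    jacksonTerm_eq hq0 hq Gγ M k j, jacksonTerm_add_one hq0 hq Gγ M k j, jacksonCert, ← hQ, ← hZ]
  linear_combination (jacksonCoeff q β γ R M j * jacksonCore q γ M k j) * id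

theorem sum_jacksonTerm_aux {b u v w x P A₁ A₂ A₃ C₂ C₃ c d B N₁ N₂ N₃ N₄ : ℂ} (h₁ : N₁ ≠ 0)
    (h₂ : N₂ ≠ 0) (h₃ : N₃ ≠ 0) :
    b * u * v * w * x * (P * (A₁ * A₂) / (C₂ * C₃) * (A₃ * (B * N₄) * (c * d))) =
      P * b * (A₁ * u * (A₂ * v)) / (C₂ * N₂ * (C₃ * N₃)) *
        (A₃ * w * B * (c * N₁⁻¹ * (x * d))) * (N₂ * N₃ * N₄ * N₁) := by
  have e₁ := inv_mul_cancel₀ h₁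
  have e₂ := inv_mul_cancel₀ h₂
  have e₃ := inv_mul_cancel₀ h₃
  calc _ = P * b * (A₁ * u * (A₂ * v)) / (C₂ * C₃) * (A₃ * w * B * (c * (x * d))) * N₄ *
        ((N₁⁻¹ * N₁) * (N₂⁻¹ * N₂) * (N₃⁻¹ * N₃)) := by rw [e₁, e₂, e₃]; ring
    _ = _ := by simp only [div_eq_mul_inv, mul_inv]; ring

/-- A form of Jackson's sum for a terminating very-well-poised balanced `₈φ₇` series. -/
theorem sum_jacksonTerm (hq0 : q ≠ 0) (hq : ‖q‖ < 1) (hβ : β ≠ 0) (hγ : γ ≠ 0) (hR : R ≠ 0)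
    (Gβ : QGeneric β q) (Gγ : QGeneric γ q) (GR : QGeneric R q) (Gx : QGeneric (β * R / γ) q)
    (M : ℤ) (k : ℕ) :
    ∑ j ∈ Finset.range (k + 1), jacksonTerm q β γ R M k j =
      (β / γ) ^ k * (qPoch (q * γ / (β * R)) q k * qPoch (R / q ^ M) q k) /
        (qPoch (q / R) q k * qPoch (β * R / (γ * q ^ M)) q k) *
        (qPoch β q k * qPoch β q (M - k) * ((qPoch q q k)⁻¹ * (qPoch q q (M - k))⁻¹)) := by
  induction k with
  | zero =>
    have h := Gγ.qPoch_add_one M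
    have d : 1 - γ * q ^ M ≠ 0 := Gγ.sub_ne_zero M
    have c := Gγ.qPoch_ne_zero hq0 M
    simp only [zero_add, Finset.range_one, Finset.sum_singleton, jacksonTerm, jacksonCoeff,
      Nat.cast_zero, qPoch_zero, sub_zero, pow_zero, mul_zero, h]
    field_simp
  | succ k ih =>
    have hZ0 : q ^ M ≠ 0 := zpow_ne_zero _ hq0
    have hqR : QGeneric (q / R) q := by
      have := GR.inv.mul_zpow hq0 1
      rwa [zpow_one, mul_comm, ← div_eq_mul_inv] at this
    have hγR := Gx.mul_zpow hq0 (-M)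
    have ex : β * R / γ * q ^ (-M) = β * R / (γ * q ^ M) := by
      rw [zpow_neg, div_mul_eq_mul_div, ← div_eq_mul_inv, div_div, mul_comm (q ^ M)]
    rw [ex] at hγR
    have n1 : (1 - q * q ^ k) ≠ 0 := by
      have := one_sub_zpow_ne_zero (n := (k : ℤ) + 1) hq0 hq (by omega)
      rwa [zpow_add_one₀ hq0, zpow_natCast, mul_comm] at this
    have n2 : (1 - q * q ^ k / R) ≠ 0 := hqR.one_sub_ne_zero k (by rw [zpow_natCast]; ring)
    have n3 : (1 - β * R * q ^ k / (γ * q ^ M)) ≠ 0 :=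
      hγR.one_sub_ne_zero k (by rw [zpow_natCast]; ring)
    have z1 : q ^ (M - (k + 1) : ℤ) = q ^ M / (q ^ k * q) := by
      rw [zpow_sub₀ hq0, zpow_add_one₀ hq0, zpow_natCast]
    have n4 : 1 - β * q ^ M / (q ^ k * q) ≠ 0 := Gβ.one_sub_ne_zero _ (by rw [z1]; ring)
    -- The range must include j = k + 1, which occurs only in the sum for k + 1. The certificate
    -- vanishes at j = 0 through 1 - q^j and at j = k + 2 through 1/(q)_{-1}.
    have key : ∑ j ∈ Finset.range (k + 2), ((1 - q * q ^ k / R) *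
        (1 - β * R * q ^ k / (γ * q ^ M)) * (1 - β * q ^ M / (q ^ k * q)) * (1 - q * q ^ k) *
        jacksonTerm q β γ R M (k + 1) j -
      β / γ * (1 - q * γ * q ^ k / (β * R)) * (1 - R * q ^ k / q ^ M) * (1 - β * q ^ k) *
        (1 - q ^ M / q ^ k) * jacksonTerm q β γ R M k j) = 0 := by
      have : ∀ j ∈ Finset.range (k + 2), _ = _ := fun j _ =>
        jackson_certificate hq0 hq hβ hγ hR Gβ Gγ GR Gx M k j (q ^ k) (q ^ M)
          (zpow_natCast q k).symm rfl
      rw [Finset.sum_congr rfl this, Finset.sum_range_sub]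
      have t1 : jacksonCert q β γ R M k (k + 2) = 0 := by
        have : qPoch q q (k + 1 - ((k + 2 : ℕ) : ℤ)) = 0 :=
          qPoch_self_of_neg hq0 (by push_cast; omega)
        rw [jacksonCert, jacksonCore, this]
        simp
      have t2 : jacksonCert q β γ R M k 0 = 0 := by simp [jacksonCert]
      rw [t1, t2, sub_zero]
    rw [Finset.sum_sub_distrib, ← Finset.mul_sum, ← Finset.mul_sum, sub_eq_zero] at key
    have last : jacksonTerm q β γ R M k (k + 1) = 0 := by
      have : qPoch q q (k - ((k + 1 : ℕ) : ℤ)) = 0 :=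
        qPoch_self_of_neg hq0 (by push_cast; omega)
      rw [jacksonTerm, this]
      simp
    rw [Finset.sum_range_succ (fun j => jacksonTerm q β γ R M k j) (k + 1), last, add_zero, ih,
      mul_comm, ← eq_div_iff (by simp only [ne_eq, mul_eq_zero, not_or]; tauto)] at key
    rw [Nat.cast_succ, key]
    have a1 := qPoch_natCast_succ (q * γ / (β * R)) q k
    have a2 := qPoch_natCast_succ (R / q ^ M) q k
    have a3 := qPoch_natCast_succ β q k
    have b1 := qPoch_natCast_succ q q k
    have b2 := qPoch_natCast_succ (q / R) q k
    have b3 := qPoch_natCast_succ (β * R / (γ * q ^ M)) q k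
    have a4 := Gβ.qPoch_add_one (M - (k + 1))
    have b4 := inv_qPoch_self hq0 hq (M - (k + 1))
    rw [sub_add_eq_sub_sub, sub_add_cancel] at a4 b4
    rw [← sub_add_eq_sub_sub, z1] at a4
    have z2 : q ^ (M - k : ℤ) = q ^ M / q ^ k := by
      rw [zpow_sub₀ hq0, zpow_natCast]
    rw [← sub_add_eq_sub_sub, z2] at b4
    rw [Nat.cast_succ] at a1 a2 a3 b1 b2 b3
    have c1 := qPoch_self_natCast_ne_zero hq0 hq k
    have c2 := hqR.qPoch_ne_zero hq0 k
    have c3 := hγR.qPoch_ne_zero hq0 k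
    rw [a1, a2, a3, b1, b2, b3, a4, b4, pow_succ]
    rw [show q * γ / (β * R) * q ^ k = q * γ * q ^ k / (β * R) by ring,
      show R / q ^ M * q ^ k = R * q ^ k / q ^ M by ring,
      show q / R * q ^ k = q * q ^ k / R by ring,
      show β * R / (γ * q ^ M) * q ^ k = β * R * q ^ k / (γ * q ^ M) by ring,
      show β * (q ^ M / (q ^ k * q)) = β * q ^ M / (q ^ k * q) by ring]
    rw [div_eq_iff (by simp only [ne_eq, mul_eq_zero, not_or]; tauto), mul_inv]
    exact sum_jacksonTerm_aux n1 n2 n3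

end Jackson

/-! ### The q-Saalschütz sum in convolution form. -/

section Saalschuetz

variable {q a b e : ℂ}

/-- The summand in the convolution form `sum_saalschuetzTerm` of the `q`-Saalschütz sum. -/
noncomputable def saalschuetzTerm (q a b e : ℂ) (n : ℤ) (i : ℕ) : ℂ :=
  qPoch a q i * qPoch b q i * e ^ i / (qPoch q q i * qPoch (a * b * e) q i) *
    (qPoch e q (n - i) * (qPoch q q (n - i))⁻¹)

/-- The antidifference certifying `sum_saalschuetzTerm`. -/
noncomputable def saalschuetzCert (q a b e : ℂ) (n : ℤ) (i : ℕ) : ℂ :=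
  -(q ^ n * q / q ^ i) * (1 - q ^ i) * (1 - a * b * e * q ^ i / q) *
    saalschuetzTerm q a b e (n + 1) i

/-- Telescopes the recurrence in n satisfied by the closed form. Once the factorials are divided
out, it is a rational identity in q^n and q^i. -/
theorem saalschuetz_certificate (hq0 : q ≠ 0) (hq : ‖q‖ < 1) (Ge : QGeneric e q)
    (hc : ∀ j : ℕ, a * b * e * q ^ j ≠ 1) (n : ℤ) (i : ℕ) :
    (1 - q * q ^ n) * (1 - a * b * e * q ^ n) * saalschuetzTerm q a b e (n + 1) i -
      (1 - b * e * q ^ n) * (1 - a * e * q ^ n) * saalschuetzTerm q a b e n i =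
    saalschuetzCert q a b e n (i + 1) - saalschuetzCert q a b e n i := by
  have hy0 : q ^ i ≠ 0 := pow_ne_zero _ hq0
  have hs : q ^ (i + 1) = q * q ^ i := pow_succ' q i
  have h1 := inv_qPoch_self hq0 hq (n - i)
  have h2 := Ge.qPoch_add_one (n - i)
  have e1 : q ^ (n - i + 1 : ℤ) = q * q ^ n / q ^ i := by
    rw [zpow_add_one₀ hq0, zpow_sub₀ hq0, zpow_natCast]; ring
  have e2 : q ^ (n - i : ℤ) = q ^ n / q ^ i := by
    rw [zpow_sub₀ hq0, zpow_natCast]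
  have a1 := qPoch_natCast_succ a q i
  have a2 := qPoch_natCast_succ b q i
  have b1 := qPoch_natCast_succ q q i
  have b2 := qPoch_natCast_succ (a * b * e) q i
  have c1 := qPoch_self_natCast_ne_zero hq0 hq i
  have c2 := qPoch_natCast_ne_zero i fun j _ => hc j
  have n1 : (1 - q * q ^ i) ≠ 0 := by
    have := one_sub_zpow_ne_zero (n := (i : ℤ) + 1) hq0 hq (by omega)
    rwa [zpow_add_one₀ hq0, zpow_natCast, mul_comm] at this
  have n2 : 1 - a * b * e * q ^ i ≠ 0 := sub_ne_zero.mpr (hc i).symm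
  have f1 : n + 1 - ((i + 1 : ℕ) : ℤ) = n - i := by push_cast; ring
  have f2 : n + 1 - (i : ℤ) = n - i + 1 := by ring
  unfold saalschuetzCert saalschuetzTerm
  rw [f1, f2, a1, a2, b1, b2, h2, h1, e1, e2, hs, pow_succ]
  have e3 : a * b * e * (q * q ^ i) / q = a * b * e * q ^ i := by field_simp
  rw [e3]
  generalize qPoch e q (n - i) = E at *
  generalize (qPoch q q (n - i + 1))⁻¹ = I at *
  generalize qPoch a q i = A at *
  generalize qPoch b q i = B at *
  generalize qPoch q q i = C at *
  generalize qPoch (a * b * e) q i = D at *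
  generalize e ^ i = P at *
  generalize q ^ n = Q at *
  generalize q ^ i = y at *
  have g : (1 - q * y) * (1 - a * b * e * y) *
      (A * (1 - a * y) * (B * (1 - b * y)) * (P * e) / (C * (1 - q * y) * (D * (1 - a * b * e * y))))
      = A * B * P / (C * D) * ((1 - a * y) * (1 - b * y) * e) := by
    rw [mul_div_assoc', div_mul_eq_mul_div, div_eq_div_iff (by simp [*]) (by simp [*])]
    ring
  have g2 : -(Q * q / (q * y)) * (1 - q * y) * (1 - a * b * e * y) *
      (A * (1 - a * y) * (B * (1 - b * y)) * (P * e) / (C * (1 - q * y) * (D * (1 - a * b * e * y))) *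
        (E * ((1 - q * Q / y) * I))) =
      -(Q / y) * (A * B * P / (C * D) * ((1 - a * y) * (1 - b * y) * e)) *
        (E * ((1 - q * Q / y) * I)) := by
    rw [← g, mul_comm Q q, mul_div_mul_left _ _ hq0]
    simp only [mul_assoc]
  rw [g2]
  generalize A * B * P / (C * D) = V
  have id : (1 - q * Q) * (1 - a * b * e * Q) * (1 - e * (Q / y)) -
      (1 - b * e * Q) * (1 - a * e * Q) * (1 - q * Q / y) =
      -(Q / y) * ((1 - a * y) * (1 - b * y) * e) * (1 - q * Q / y) +
      Q * q / y * (1 - y) * (1 - a * b * e * y / q) * (1 - e * (Q / y)) := by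
    field_simp
    ring
  linear_combination (V * E * I) * id

/-- The `q`-Saalschütz sum, in convolution form. -/
theorem sum_saalschuetzTerm (hq0 : q ≠ 0) (hq : ‖q‖ < 1) (Ge : QGeneric e q)
    (hc : ∀ j : ℕ, a * b * e * q ^ j ≠ 1) (n : ℕ) :
    ∑ i ∈ Finset.range (n + 1), saalschuetzTerm q a b e n i =
      qPoch (b * e) q n * qPoch (a * e) q n / (qPoch q q n * qPoch (a * b * e) q n) := by
  induction n with
  | zero => simp [saalschuetzTerm, qPoch_zero]
  | succ n ih =>
    have key : ∑ i ∈ Finset.range (n + 2),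
        ((1 - q * q ^ n) * (1 - a * b * e * q ^ n) * saalschuetzTerm q a b e (n + 1) i -
        (1 - b * e * q ^ n) * (1 - a * e * q ^ n) * saalschuetzTerm q a b e n i) = 0 := by
      have h : ∀ i ∈ Finset.range (n + 2), _ = _ := fun i _ =>
        saalschuetz_certificate hq0 hq Ge hc n i
      simp only [zpow_natCast] at h
      rw [Finset.sum_congr rfl h, Finset.sum_range_sub]
      have t1 : saalschuetzCert q a b e n (n + 2) = 0 := by
        have : qPoch q q (n + 1 - ((n + 2 : ℕ) : ℤ)) = 0 :=
          qPoch_self_of_neg hq0 (by push_cast; omega)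
        rw [saalschuetzCert, saalschuetzTerm, this]
        simp
      have t2 : saalschuetzCert q a b e n 0 = 0 := by simp [saalschuetzCert]
      rw [t1, t2, sub_zero]
    rw [Finset.sum_sub_distrib, ← Finset.mul_sum, ← Finset.mul_sum, sub_eq_zero] at key
    have last : saalschuetzTerm q a b e n (n + 1) = 0 := by
      have : qPoch q q (n - ((n + 1 : ℕ) : ℤ)) = 0 :=
        qPoch_self_of_neg hq0 (by push_cast; omega)
      rw [saalschuetzTerm, this]
      simp
    have n1 : (1 - q * q ^ n) ≠ 0 := by
      have := one_sub_zpow_ne_zero (n := (n : ℤ) + 1) hq0 hq (by omega)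
      rwa [zpow_add_one₀ hq0, zpow_natCast, mul_comm] at this
    have n2 : 1 - a * b * e * q ^ n ≠ 0 := sub_ne_zero.mpr (hc n).symm
    have c1 := qPoch_self_natCast_ne_zero hq0 hq n
    have c2 := qPoch_natCast_ne_zero n fun j _ => hc j
    rw [Finset.sum_range_succ (fun i => saalschuetzTerm q a b e n i) (n + 1), last, add_zero, ih,
      mul_comm, ← eq_div_iff (mul_ne_zero n1 n2)] at key
    rw [Nat.cast_succ, key, ← Nat.cast_succ, qPoch_natCast_succ, qPoch_natCast_succ,
      qPoch_natCast_succ, qPoch_natCast_succ]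
    rw [mul_div_assoc', div_div, div_eq_div_iff (by simp [*]) (by simp [*])]
    ring

end Saalschuetz

/-! ### Matching the expansion coefficients with the terms of the right-hand side. -/

theorem qPoch_natCast_add (a : ℂ) (q : ℂ) (n k : ℕ) :
    qPoch a q ((n + k : ℕ) : ℤ) = qPoch a q n * qPoch (a * q ^ n) q k := by
  simp only [qPoch_natCast, Finset.prod_range_add, pow_add, mul_assoc]

/-- Factor j - 1 - i on the left is, up to -a^{-1}q^{-i}, factor i on the right. The last product
does not involve a, so it cancels in `qPoch_reverse_mul`. -/
theorem qPoch_reverse {a q : ℂ} (hq0 : q ≠ 0) (ha : a ≠ 0) (j : ℕ) :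
    qPoch (q / (a * q ^ j)) q j * a ^ j =
      qPoch a q j * ∏ i ∈ Finset.range j, -(q ^ i)⁻¹ := by
  have h : a ^ j = ∏ _i ∈ Finset.range j, a := by simp
  rw [qPoch_natCast, qPoch_natCast, h, ← Finset.prod_range_reflect, ← Finset.prod_mul_distrib,
    ← Finset.prod_mul_distrib]
  refine Finset.prod_congr rfl fun i hi => ?_
  have hi' := Finset.mem_range.mp hi
  have e : q ^ j = q * q ^ (j - 1 - i) * q ^ i := by
    rw [← pow_succ', ← pow_add]
    congr 1
    omega
  have h1 : q ^ (j - 1 - i) ≠ 0 := pow_ne_zero _ hq0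
  have h2 : q ^ i ≠ 0 := pow_ne_zero _ hq0
  rw [e]
  field_simp
  ring

theorem qPoch_reverse_mul {a q c : ℂ} (hq0 : q ≠ 0) (ha : a ≠ 0) (hc : c ≠ 0) (j : ℕ) :
    qPoch (c * a) q j * qPoch (q / (a * q ^ j)) q j =
      qPoch a q j * qPoch (q / (c * a * q ^ j)) q j * c ^ j := by
  have h1 := qPoch_reverse hq0 ha j
  have h2 := qPoch_reverse hq0 (mul_ne_zero hc ha) j
  have h3 : a ^ j ≠ 0 := pow_ne_zero _ ha
  rw [mul_pow] at h2
  have h4 : (∏ i ∈ Finset.range j, -(q ^ i)⁻¹) ≠ 0 :=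
    Finset.prod_ne_zero_iff.mpr fun i _ => neg_ne_zero.mpr (inv_ne_zero (pow_ne_zero _ hq0))
  refine mul_right_cancel₀ (mul_ne_zero h3 h4) ?_
  linear_combination qPoch (c * a) q j * (∏ i ∈ Finset.range j, -(q ^ i)⁻¹) * h1 -
    qPoch a q j * (∏ i ∈ Finset.range j, -(q ^ i)⁻¹) * h2

theorem QGeneric.div_left {a q : ℂ} (h : QGeneric a q) (hq0 : q ≠ 0) (n : ℤ) :
    QGeneric (q ^ n / a) q := by
  have := h.inv.mul_zpow hq0 n
  rwa [mul_comm, ← div_eq_mul_inv] at this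

theorem QGeneric.reflect_shift {x y q : ℂ} (hx : QGeneric x q) (hy : QGeneric y q) (hq0 : q ≠ 0)
    (hx0 : x ≠ 0) (hy0 : y ≠ 0) (s j : ℤ) :
    qPoch (q / x) q s * qPoch (y * q ^ (-s)) q j * qPoch x q (j - s) * x ^ s =
      y ^ s * qPoch (q / y) q s * qPoch (x * q ^ (-s)) q j * qPoch y q (j - s) := by
  have h := hx.reflect hy hq0 hx0 hy0 s
  rw [show j - s = -s + j by ring, hx.qPoch_add hq0, hy.qPoch_add hq0]
  linear_combination qPoch (y * q ^ (-s)) q j * qPoch (x * q ^ (-s)) q j * h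

section Finite

variable {q β γ ρ : ℂ}

/-- The algebra of `coeff_parameter_identity` with the factorials as indeterminates: `E₁`, `E₃` are
instances of `QGeneric.reflect_shift`, and `E₂`, `E₄` of `qPoch_reverse_mul`. -/
theorem coeff_parameter_aux {b g b' g' r x A₁ A₂ A₃ A₄ S₁ S₂ S₃ S₄ X Y U V P Q N₁ N₂ D₁ D₂ : ℂ}
    (hb : b ≠ 0) (hg : g ≠ 0) (hg' : g' ≠ 0) (hr : r ≠ 0) (hx : x ≠ 0) (h₁ : S₁ ≠ 0)
    (h₃ : S₃ ≠ 0) (_hU : U ≠ 0) (_hV : V ≠ 0) (hY : Y ≠ 0) (hX : X ≠ 0) (hA₂ : A₂ ≠ 0)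
    (hA₄ : A₄ ≠ 0) (h₂ : S₂ ≠ 0) (h₄ : S₄ ≠ 0) (hD₁ : D₁ ≠ 0) (hD₂ : D₂ ≠ 0)
    (E₁ : A₁ * S₁ * X * (b * r / g) = r * A₂ * S₂ * U) (E₂ : P * D₁ = S₁ * N₁ * b')
    (E₃ : A₃ * S₃ * Y * x = g / b * x * A₄ * S₄ * V) (E₄ : Q * D₂ = S₃ * N₂ * b') :
    b * (A₁ * A₃ * P * Q) / (A₂ * A₄ * S₂ * S₄) =
      U * V / (Y * X) * (b' * g / (g' * b)) * (b' * g' * g * (N₁ * N₂) / (D₁ * D₂)) := by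
  have e₁ : A₁ = A₂ * S₂ * U * g / (S₁ * X * b) := by
    rw [eq_div_iff (by simp [*])]
    rw [mul_div_assoc', div_eq_iff hg] at E₁
    exact mul_left_cancel₀ hr (by linear_combination E₁)
  have e₃ : A₃ = A₄ * S₄ * V * g / (S₃ * Y * b) := by
    rw [eq_div_iff (by simp [*])]
    rw [div_mul_eq_mul_div, div_mul_eq_mul_div, div_mul_eq_mul_div, div_mul_eq_mul_div,
      eq_div_iff hb] at E₃
    exact mul_left_cancel₀ hx (by linear_combination E₃)
  rw [← eq_div_iff hD₁] at E₂
  rw [← eq_div_iff hD₂] at E₄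
  rw [e₁, e₃, E₂, E₄]
  field_simp

/-- This isolates all factors containing ρ. Reflection pairs ρ with βρ/γ, and q^{1+m}/ρ with
γq^{1+m}/(βρ), to trade (s, j) for L = j - s; reversal handles the two remaining pairs of length j.
-/
theorem coeff_parameter_identity (hq0 : q ≠ 0) (hβ : β ≠ 0) (hγ : γ ≠ 0) (hρ : ρ ≠ 0)
    (Gρ : QGeneric ρ q) (Gx : QGeneric (β * ρ / γ) q) (m s j : ℕ) (L M : ℤ) (hL : L = j - s)
    (hM : M = m + 2 * L) :
    β ^ s * (qPoch (γ * q / (β * ρ)) q s * qPoch (ρ * q ^ (-(m : ℤ))) q s *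
      qPoch (ρ * β * q ^ (-(s : ℤ))) q j * qPoch (γ * q ^ (1 + (m : ℤ) - s) / ρ) q j) /
      (qPoch (q / ρ) q s * qPoch (β * ρ * q ^ (-(m : ℤ)) / γ) q s *
        qPoch (β * ρ * q ^ (-(s : ℤ)) / γ) q j * qPoch (q ^ (1 + (m : ℤ) - s) / ρ) q j) =
    qPoch ρ q L * qPoch (γ * q ^ (1 + m) / (β * ρ)) q L /
      (qPoch (q ^ (1 + m) / ρ) q L * qPoch (β * ρ / γ) q L) * (β / γ) ^ L *
      ((β * γ) ^ j * γ ^ s * (qPoch (q / (ρ * q ^ L * β)) q j *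
        qPoch (ρ * q ^ L / (γ * q ^ M)) q j) /
        (qPoch (q / (ρ * q ^ L)) q j * qPoch (β * (ρ * q ^ L) / (γ * q ^ M)) q j)) := by
  have hx0 : β * ρ / γ ≠ 0 := div_ne_zero (mul_ne_zero hβ hρ) hγ
  have G2 : QGeneric (q ^ (1 + m) / ρ) q := by
    have := Gρ.div_left hq0 ((1 + m : ℕ) : ℤ)
    rwa [zpow_natCast] at this
  have G3 : QGeneric (γ * q ^ (1 + m) / (β * ρ)) q := by
    have := Gx.div_left hq0 ((1 + m : ℕ) : ℤ)
    rwa [zpow_natCast, div_div_eq_mul_div, mul_comm] at this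
  have hqm : q ^ (1 + m) ≠ 0 := pow_ne_zero _ hq0
  have h20 : q ^ (1 + m) / ρ ≠ 0 := div_ne_zero hqm hρ
  have h30 : γ * q ^ (1 + m) / (β * ρ) ≠ 0 :=
    div_ne_zero (mul_ne_zero hγ hqm) (mul_ne_zero hβ hρ)
  have E1 := Gx.reflect_shift Gρ hq0 hx0 hρ s j
  have E3 := G2.reflect_shift G3 hq0 h20 h30 s j
  have hs0 : q ^ (-(s : ℤ)) ≠ 0 := zpow_ne_zero _ hq0
  have hL' : q ^ L = q ^ (-(s : ℤ)) * q ^ j := by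
    rw [hL, sub_eq_neg_add, zpow_add₀ hq0, zpow_natCast]
  have hLs : q ^ L = q ^ j / q ^ s := by rw [hL, zpow_sub₀ hq0, zpow_natCast, zpow_natCast]
  have hM' : q ^ M = q ^ m * (q ^ j / q ^ s) ^ 2 := by
    rw [hM, zpow_add₀ hq0, zpow_natCast, mul_comm 2 L, zpow_mul, hLs]; rfl
  have hms : q ^ (1 + (m : ℤ) - s) = q ^ (1 + m) * q ^ (-(s : ℤ)) := by
    rw [sub_eq_add_neg, zpow_add₀ hq0]; norm_cast
  have E2 := qPoch_reverse_mul hq0 (mul_ne_zero hρ hs0) hβ j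
  have E4 := qPoch_reverse_mul hq0 (mul_ne_zero h30 hs0) hβ j
  have hj0 : q ^ j ≠ 0 := pow_ne_zero _ hq0
  have hsn : q ^ s ≠ 0 := pow_ne_zero _ hq0
  have hmn : q ^ m ≠ 0 := pow_ne_zero _ hq0
  rw [← hL] at E1 E3
  rw [show q / (β * ρ / γ) = γ * q / (β * ρ) by field_simp,
    show β * ρ / γ * q ^ (-(s : ℤ)) = β * ρ * q ^ (-(s : ℤ)) / γ by ring] at E1
  rw [show q / (q ^ (1 + m) / ρ) = ρ * q ^ (-(m : ℤ)) by
      rw [zpow_neg, zpow_natCast, pow_add, pow_one]; field_simp,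
    show q / (γ * q ^ (1 + m) / (β * ρ)) = β * ρ * q ^ (-(m : ℤ)) / γ by
      rw [zpow_neg, zpow_natCast, pow_add, pow_one]; field_simp,
    show q ^ (1 + m) / ρ * q ^ (-(s : ℤ)) = q ^ (1 + (m : ℤ) - s) / ρ by rw [hms]; ring] at E3
  rw [show β * (ρ * q ^ (-(s : ℤ))) = ρ * β * q ^ (-(s : ℤ)) by ring,
    show ρ * q ^ (-(s : ℤ)) * q ^ j = ρ * q ^ L by rw [hL']; ring,
    show ρ * β * q ^ (-(s : ℤ)) * q ^ j = ρ * q ^ L * β by rw [hL']; ring] at E2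
  rw [show β * (γ * q ^ (1 + m) / (β * ρ) * q ^ (-(s : ℤ))) = γ * q ^ (1 + (m : ℤ) - s) / ρ by
      rw [hms]; field_simp,
    show q / (γ * q ^ (1 + m) / (β * ρ) * q ^ (-(s : ℤ)) * q ^ j) =
      β * (ρ * q ^ L) / (γ * q ^ M) by
      rw [hM', hLs, zpow_neg, zpow_natCast, pow_add, pow_one]; field_simp,
    show q / (γ * q ^ (1 + (m : ℤ) - s) / ρ * q ^ j) = ρ * q ^ L / (γ * q ^ M) by
      rw [hM', hms, hLs, zpow_neg, zpow_natCast, pow_add, pow_one]; field_simp] at E4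
  have n1 : qPoch (ρ * q ^ (-(s : ℤ))) q j ≠ 0 := (Gρ.mul_zpow hq0 _).qPoch_ne_zero hq0 _
  have n2 := (G3.mul_zpow hq0 (-(s : ℤ))).qPoch_ne_zero hq0 j
  have n3 := Gρ.qPoch_ne_zero hq0 L
  have n4 := G3.qPoch_ne_zero hq0 L
  have n5 := G2.qPoch_ne_zero hq0 L
  have n6 := Gx.qPoch_ne_zero hq0 L
  have n7 : qPoch (q / ρ) q s ≠ 0 := by
    have := Gρ.div_left hq0 1
    rw [zpow_one] at this
    exact this.qPoch_ne_zero hq0 _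
  have n8 : qPoch (β * ρ * q ^ (-(m : ℤ)) / γ) q s ≠ 0 := by
    have := (Gx.mul_zpow hq0 (-(m : ℤ))).qPoch_ne_zero hq0 s
    rwa [div_mul_eq_mul_div] at this
  have n9 : qPoch (β * ρ * q ^ (-(s : ℤ)) / γ) q j ≠ 0 := by
    have := (Gx.mul_zpow hq0 (-(s : ℤ))).qPoch_ne_zero hq0 j
    rwa [div_mul_eq_mul_div] at this
  have n10 : qPoch (q ^ (1 + (m : ℤ) - s) / ρ) q j ≠ 0 := 
    (Gρ.div_left hq0 _).qPoch_ne_zero hq0 j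
  have n11 : qPoch (q / (ρ * q ^ L)) q j ≠ 0 := by
    have := (Gρ.mul_zpow hq0 L).div_left hq0 1
    rw [zpow_one] at this
    exact this.qPoch_ne_zero hq0 _
  have n12 : qPoch (β * (ρ * q ^ L) / (γ * q ^ M)) q j ≠ 0 := by
    have := (Gx.mul_zpow hq0 (L - M)).qPoch_ne_zero hq0 j
    rwa [zpow_sub₀ hq0, show β * ρ / γ * (q ^ L / q ^ M) = β * (ρ * q ^ L) / (γ * q ^ M) by
      ring] at this
  have pβ : β ^ s ≠ 0 := pow_ne_zero _ hβ
  have pγ : γ ^ s ≠ 0 := pow_ne_zero _ hγ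
  have pγj : γ ^ j ≠ 0 := pow_ne_zero _ hγ
  have pρ : ρ ^ s ≠ 0 := pow_ne_zero _ hρ
  have p2 : (q ^ (1 + m) / ρ) ^ s ≠ 0 := pow_ne_zero _ h20
  have hy2 : γ * q ^ (1 + m) / (β * ρ) = γ / β * (q ^ (1 + m) / ρ) := by ring
  rw [show (γ * q ^ (1 + m) / (β * ρ)) ^ (s : ℤ) = (γ / β * (q ^ (1 + m) / ρ)) ^ s by
    rw [← hy2, zpow_natCast], zpow_natCast, mul_pow, div_pow γ β] at E3
  rw [zpow_natCast, zpow_natCast, div_pow, mul_pow] at E1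
  have hpow : (β / γ) ^ L = β ^ j * γ ^ s / (γ ^ j * β ^ s) := by
    rw [hL, zpow_sub₀ (div_ne_zero hβ hγ), zpow_natCast, zpow_natCast, div_pow, div_pow,
      div_div_div_eq]
  rw [hpow, mul_pow]
  exact coeff_parameter_aux pβ pγ pγj pρ p2 n1 n2 n3 n4 n5 n6 n7 n8 n9 n10 n11 n12 E1 E2 E3 E4

end Finite

section Finite

variable {q β γ ρ : ℂ}

theorem rhsCoeff_mul_qHypTerm (hq0 : q ≠ 0) (hq : ‖q‖ < 1) (hβ : β ≠ 0) (hγ : γ ≠ 0) (hρ : ρ ≠ 0)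
    (Gρ : QGeneric ρ q) (Gx : QGeneric (β * ρ / γ) q) (n s j : ℕ) (L M : ℤ) (hL : L = j - s)
    (hM : M = (n + 2 * s : ℕ) + 2 * L) :
    rhsCoeff q β γ ρ (n + 2 * s) s * (q / β ^ 2) ^ s *
      qHypTerm (upperParams q β γ ρ (n + 2 * s) s) (lowerParams q β γ ρ (n + 2 * s) s) q 1 j =
    qPoch ρ q L * qPoch (γ * q ^ (1 + (n + 2 * s)) / (β * ρ)) q L /
      (qPoch (q ^ (1 + (n + 2 * s)) / ρ) q L * qPoch (β * ρ / γ) q L) * (β / γ) ^ L *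
      (jacksonCoeff q β γ (ρ * q ^ L) M j * (γ ^ s * (qPoch (q / γ) q s / qPoch (γ * q) q s *
        (qPoch (γ ^ 2) q n * qPoch (q * q ^ s) q n /
          (qPoch q q n * qPoch (γ * q * q ^ s) q n))))) := by
  have core := coeff_parameter_identity hq0 hβ hγ hρ Gρ Gx (n + 2 * s) s j L M hL hM
  have i1 : ((n + 2 * s : ℕ) : ℤ) - 2 * s = n := by push_cast; ring
  have i2 : ((n + 2 * s : ℕ) : ℤ) - s = (s + n : ℕ) := by push_cast; ring
  have i3 : M - j = (n + j : ℕ) := by rw [hM, hL]; push_cast; ring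
  have i4 : M - 2 * j = n := by rw [hM, hL]; push_cast; ring
  have i5 : M - j + 1 = (1 + (n + j) : ℕ) := by rw [i3]; push_cast; ring
  have i6 : 1 + ((n + 2 * s : ℕ) : ℤ) - 2 * s = (1 + n : ℕ) := by push_cast; ring
  have a1 := qPoch_natCast_add β q n j
  have a2 := qPoch_natCast_add q q s n
  have a3 := qPoch_natCast_add (γ * q) q s n
  have a4 := qPoch_natCast_add γ q 1 (n + j)
  have a5 := qPoch_natCast_add (γ * q) q n j
  have a6 : qPoch γ q (1 : ℕ) = 1 - γ := by
    rw [qPoch_natCast]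
    simp
  rw [pow_one, a5, a6] at a4
  have pw : (β ^ 3 / q) ^ s * (q / β ^ 2) ^ s = β ^ s := by
    rw [← mul_pow]
    congr 1
    field_simp
  have c1 : qPoch q q s ≠ 0 := qPoch_self_natCast_ne_zero hq0 hq s
  unfold rhsCoeff qHypTerm upperParams lowerParams jacksonCoeff
  simp only [qPochs, List.map_cons, List.map_nil, List.prod_cons, List.prod_nil, mul_one]
  rw [i1, i2, i5, i3, i4, i6, a1, a2, a3, a4, zpow_natCast, zpow_natCast, one_pow, mul_one,
    show γ * q ^ (1 + n) = γ * q * q ^ n by rw [pow_add, pow_one, mul_assoc]]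
  have hX : qPoch q q s * (qPoch q q s)⁻¹ = 1 := mul_inv_cancel₀ c1
  -- `X` collects the factors free of ρ. The factor `hX` accounts for (q)_s, which occurs in the
  -- denominator and, through (q)_{s+n}, in the numerator.
  set X := (1 - γ * q ^ n) * qPoch (β / γ) q j * qPoch β q n * qPoch (β * q ^ n) q j /
    (qPoch q q j * (1 - γ) * qPoch (γ * q) q n * qPoch (γ * q * q ^ n) q j) *
    (qPoch (q / γ) q s / qPoch (γ * q) q s * (qPoch (γ ^ 2) q n * qPoch (q * q ^ s) q n /
      (qPoch q q n * qPoch (γ * q * q ^ s) q n))) with hXdef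
  refine Eq.trans ?_ ((congrArg (X * ·) core).trans ?_)
  · rw [← pw]
    generalize (β ^ 3 / q) ^ s = b₁
    generalize (q / β ^ 2) ^ s = b₂
    refine Eq.trans ?_ ((congrArg (_ * ·) hX).trans (mul_one _))
    rw [hXdef]
    simp only [div_eq_mul_inv, mul_inv]
    ring
  · rw [hXdef]
    simp only [div_eq_mul_inv, mul_inv]
    ring

end Finite

/-! ### The finite identity for generic parameters. -/

/-- The factor of the bilateral series which does not involve `(β q^m)_{2n} / (q^{1+m}/β)_{2n}`,
rescaled by `(β^2/q)^n`. -/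
noncomputable def bilateralCoeff (q β γ ρ : ℂ) (m : ℕ) (n : ℤ) : ℂ :=
  qPochs [1 / γ, ρ, γ * q ^ (1 + m) / (β * ρ)] q n /
    qPochs [γ, q ^ (1 + m) / ρ, β * ρ / γ] q n * β ^ n

/-- The summand `γ^N (q/γ)_N / (γq)_N`. -/
noncomputable def ultrasphericalWeight (q γ : ℂ) (N : ℤ) : ℂ :=
  γ ^ N * (qPoch (q / γ) q N / qPoch (γ * q) q N)

section Finite

variable {q β γ ρ : ℂ}

theorem qPoch_inv_div_qPoch (hq0 : q ≠ 0) (hγ : γ ≠ 0) (Gγ : QGeneric γ q) (N : ℤ) :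
    qPoch (1 / γ) q (-N) / qPoch γ q (-N) = γ ^ N * ultrasphericalWeight q γ N := by
  have Gi : QGeneric (1 / γ) q := by rw [one_div]; exact Gγ.inv
  have h := Gi.reflect Gγ hq0 (one_div_ne_zero hγ) hγ N
  have h1 := Gγ.qPoch_ne_zero hq0 (-N)
  have h2 : qPoch (γ * q) q N ≠ 0 := by
    have := (Gγ.mul_zpow hq0 1).qPoch_ne_zero hq0 N
    rwa [zpow_one] at this
  have h3 : γ ^ N ≠ 0 := zpow_ne_zero _ hγ
  rw [show q / (1 / γ) = γ * q by field_simp, one_div, inv_zpow] at h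
  rw [one_div, ultrasphericalWeight]
  field_simp at h ⊢
  linear_combination h

/-- Splitting the index L - k separates a factor depending only on L from factorials of index -k.
Reflected to index k, the latter are the closed form of the Jackson sum with R = ρq^L; the pair 1/γ,
γ gives the weight. -/
theorem bilateralCoeff_sub_mul (hq0 : q ≠ 0) (hq : ‖q‖ < 1) (hβ : β ≠ 0) (hγ : γ ≠ 0) (hρ : ρ ≠ 0)
    (Gβ : QGeneric β q) (Gγ : QGeneric γ q) (Gρ : QGeneric ρ q) (Gx : QGeneric (β * ρ / γ) q)
    (m k : ℕ) (L M : ℤ) (hM : M = m + 2 * L) :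
    bilateralCoeff q β γ ρ m (L - k) *
      (qPoch β q k * qPoch β q (M - k) * ((qPoch q q k)⁻¹ * (qPoch q q (M - k))⁻¹)) =
    qPoch ρ q L * qPoch (γ * q ^ (1 + m) / (β * ρ)) q L /
      (qPoch (q ^ (1 + m) / ρ) q L * qPoch (β * ρ / γ) q L) * (β / γ) ^ L *
      (ultrasphericalWeight q γ (k - L) *
        ∑ j ∈ Finset.range (k + 1), jacksonTerm q β γ (ρ * q ^ L) M k j) := by
  have hL0 : q ^ L ≠ 0 := zpow_ne_zero _ hq0
  have hZ0 : q ^ M ≠ 0 := zpow_ne_zero _ hq0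
  have hR : ρ * q ^ L ≠ 0 := mul_ne_zero hρ hL0
  have GR := Gρ.mul_zpow hq0 L
  have GX : QGeneric (β * (ρ * q ^ L) / γ) q := by
    have := Gx.mul_zpow hq0 L
    rwa [show β * ρ / γ * q ^ L = β * (ρ * q ^ L) / γ by ring] at this
  have hX0 : β * (ρ * q ^ L) / γ ≠ 0 := div_ne_zero (mul_ne_zero hβ hR) hγ
  have GW : QGeneric (q * q ^ M / (ρ * q ^ L)) q := by
    have := GR.div_left hq0 (M + 1)
    rwa [zpow_add_one₀ hq0, mul_comm (q ^ M)] at this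
  have GY : QGeneric (γ / β * (q * q ^ M / (ρ * q ^ L))) q := by
    have := GX.div_left hq0 (M + 1)
    rwa [zpow_add_one₀ hq0, show q ^ M * q / (β * (ρ * q ^ L) / γ) =
      γ / β * (q * q ^ M / (ρ * q ^ L)) by field_simp] at this
  have hW0 : q * q ^ M / (ρ * q ^ L) ≠ 0 := div_ne_zero (mul_ne_zero hq0 hZ0) hR
  have hY0 : γ / β * (q * q ^ M / (ρ * q ^ L)) ≠ 0 := mul_ne_zero (div_ne_zero hγ hβ) hW0
  have hqM : q ^ M = q ^ m * (q ^ L) ^ 2 := by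
    rw [hM, zpow_add₀ hq0, zpow_natCast, mul_comm 2 L, zpow_mul]; rfl
  have eW : q * q ^ M / (ρ * q ^ L) = q ^ (1 + m) / ρ * q ^ L := by
    rw [hqM, pow_add, pow_one]; field_simp
  have eY : γ / β * (q * q ^ M / (ρ * q ^ L)) = γ * q ^ (1 + m) / (β * ρ) * q ^ L := by
    rw [eW]; ring
  have G2 : QGeneric (q ^ (1 + m) / ρ) q := by
    have := Gρ.div_left hq0 ((1 + m : ℕ) : ℤ)
    rwa [zpow_natCast] at this
  have G3 : QGeneric (γ * q ^ (1 + m) / (β * ρ)) q := by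
    have := Gx.div_left hq0 ((1 + m : ℕ) : ℤ)
    rwa [zpow_natCast, div_div_eq_mul_div, mul_comm] at this
  have r1 := GR.reflect GX hq0 hR hX0 k
  have r2 := GY.reflect GW hq0 hY0 hW0 k
  have qW : q / (q * q ^ M / (ρ * q ^ L)) = ρ * q ^ L / q ^ M := by field_simp
  have qY : q / (γ / β * (q * q ^ M / (ρ * q ^ L))) = β * (ρ * q ^ L) / (γ * q ^ M) := by
    field_simp
  have qX : q / (β * (ρ * q ^ L) / γ) = q * γ / (β * (ρ * q ^ L)) := by field_simp
  rw [qX] at r1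
  rw [qY, qW, mul_zpow] at r2
  rw [sum_jacksonTerm hq0 hq hβ hγ hR Gβ Gγ GR GX]
  simp only [bilateralCoeff, qPochs, List.map_cons, List.map_nil, List.prod_cons, List.prod_nil,
    mul_one]
  have wt := qPoch_inv_div_qPoch hq0 hγ Gγ (k - L)
  rw [neg_sub] at wt
  have s1 := Gρ.qPoch_add hq0 L (-k)
  have s2 := Gx.qPoch_add hq0 L (-k)
  have s3 := G2.qPoch_add hq0 L (-k)
  have s4 := G3.qPoch_add hq0 L (-k)
  rw [← sub_eq_add_neg] at s1 s2 s3 s4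
  rw [show β * ρ / γ * q ^ L = β * (ρ * q ^ L) / γ by ring] at s2
  rw [← eW] at s3
  rw [← eY] at s4
  have n1 := GX.qPoch_ne_zero hq0 (-k)
  have n2 := GW.qPoch_ne_zero hq0 (-k)
  have n3 : qPoch (q / (ρ * q ^ L)) q k ≠ 0 := by
    have := (GR.div_left hq0 1).qPoch_ne_zero hq0 k
    rwa [zpow_one] at this
  have n4 : qPoch (β * (ρ * q ^ L) / (γ * q ^ M)) q k ≠ 0 := by
    have := (GX.mul_zpow hq0 (-M)).qPoch_ne_zero hq0 k
    rwa [zpow_neg, show β * (ρ * q ^ L) / γ * (q ^ M)⁻¹ = β * (ρ * q ^ L) / (γ * q ^ M) by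
      simp only [div_eq_mul_inv, mul_inv]; ring] at this
  have hRk : (ρ * q ^ L) ^ k ≠ 0 := pow_ne_zero _ hR
  have hWk : (q * q ^ M / (ρ * q ^ L)) ^ k ≠ 0 := pow_ne_zero _ hW0
  have r1' : qPoch (ρ * q ^ L) q (-k) / qPoch (β * (ρ * q ^ L) / γ) q (-k) =
      (β / γ) ^ k * (qPoch (q * γ / (β * (ρ * q ^ L))) q k / qPoch (q / (ρ * q ^ L)) q k) := by
    rw [mul_div_assoc' ((β / γ) ^ k), div_eq_div_iff n1 n3]
    refine mul_right_cancel₀ hRk ?_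
    rw [zpow_natCast, zpow_natCast, show β * (ρ * q ^ L) / γ = β / γ * (ρ * q ^ L) by ring,
      mul_pow (β / γ)] at r1
    rw [show β * (ρ * q ^ L) / γ = β / γ * (ρ * q ^ L) by ring]
    linear_combination r1
  have hγβ : (γ / β) ^ k * (β / γ) ^ k = 1 := by
    rw [← mul_pow, show γ / β * (β / γ) = 1 by field_simp, one_pow]
  have r2' : qPoch (γ / β * (q * q ^ M / (ρ * q ^ L))) q (-k) /
      qPoch (q * q ^ M / (ρ * q ^ L)) q (-k) =
      (β / γ) ^ k * (qPoch (ρ * q ^ L / q ^ M) q k / qPoch (β * (ρ * q ^ L) / (γ * q ^ M)) q k) := by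
    rw [mul_div_assoc' ((β / γ) ^ k), div_eq_div_iff n2 n4]
    refine mul_right_cancel₀ hWk ?_
    rw [zpow_natCast, zpow_natCast] at r2
    linear_combination (β / γ) ^ k * r2 - qPoch (γ / β * (q * q ^ M / (ρ * q ^ L))) q (-k) *
      qPoch (β * (ρ * q ^ L) / (γ * q ^ M)) q k * (q * q ^ M / (ρ * q ^ L)) ^ k * hγβ
  have hp : γ ^ (k - L : ℤ) * β ^ (L - k : ℤ) * (β / γ) ^ k = (β / γ) ^ L := by
    rw [zpow_sub₀ hγ, zpow_sub₀ hβ, div_zpow, div_pow, zpow_natCast, zpow_natCast]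
    have := pow_ne_zero k hβ
    have := pow_ne_zero k hγ
    field_simp
  rw [s1, s2, s3, s4]
  set T := qPoch β q k * qPoch β q (M - k) * ((qPoch q q k)⁻¹ * (qPoch q q (M - k))⁻¹)
  set PL := qPoch ρ q L * qPoch (γ * q ^ (1 + m) / (β * ρ)) q L /
      (qPoch (q ^ (1 + m) / ρ) q L * qPoch (β * ρ / γ) q L) with hPL
  calc _ = PL * (qPoch (1 / γ) q (L - k) / qPoch γ q (L - k)) * β ^ (L - k : ℤ) *
        (qPoch (ρ * q ^ L) q (-k) / qPoch (β * (ρ * q ^ L) / γ) q (-k)) *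
        (qPoch (γ / β * (q * q ^ M / (ρ * q ^ L))) q (-k) /
          qPoch (q * q ^ M / (ρ * q ^ L)) q (-k)) * T := by
        rw [hPL]
        simp only [div_eq_mul_inv, mul_inv]
        ring
    _ = _ := by
        rw [wt, r1', r2', ← hp]
        simp only [div_eq_mul_inv, mul_inv]
        ring

end Finite

section Finite

variable {q β γ ρ R : ℂ}

theorem jacksonTerm_of_lt (hq0 : q ≠ 0) {M k : ℤ} {j : ℕ} (h : k < j ∨ M - j < k) :
    jacksonTerm q β γ R M k j = 0 := by
  rcases h with h | h
  · rw [jacksonTerm, qPoch_self_of_neg hq0 (show k - (j : ℤ) < 0 by omega)]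
    simp
  · rw [jacksonTerm, qPoch_self_of_neg hq0 (show M - k - (j : ℤ) < 0 by omega)]
    simp

theorem ultrasphericalWeight_add (hq0 : q ≠ 0) (hγ : γ ≠ 0) (Gγ : QGeneric γ q) (s : ℤ) (i : ℕ) :
    ultrasphericalWeight q γ (s + i) = ultrasphericalWeight q γ s *
      (γ ^ i * (qPoch (q * q ^ s / γ) q i / qPoch (γ * q * q ^ s) q i)) := by
  have G1 : QGeneric (q / γ) q := by
    have := Gγ.div_left hq0 1
    rwa [zpow_one] at this
  have G2 : QGeneric (γ * q) q := by
    have := Gγ.mul_zpow hq0 1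
    rwa [zpow_one] at this
  unfold ultrasphericalWeight
  rw [G1.qPoch_add hq0, G2.qPoch_add hq0, zpow_add₀ hγ, zpow_natCast,
    show q / γ * q ^ s = q * q ^ s / γ by ring]
  simp only [div_eq_mul_inv, mul_inv]
  ring

/-- Only j ≤ k ≤ n + j contributes, since 1/(q)_{k-j} and 1/(q)_{M-k-j} vanish elsewhere. With k = j
+ i, what remains is a q-Saalschütz sum over i. -/
theorem sum_ultrasphericalWeight_mul_jacksonTerm (hq0 : q ≠ 0) (hq : ‖q‖ < 1) (hγ : γ ≠ 0)
    (Gγ : QGeneric γ q) (L : ℤ) (n j : ℕ) :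
    ∑ k ∈ Finset.range (n + 2 * j + 1),
      ultrasphericalWeight q γ (k - L) * jacksonTerm q β γ R (n + 2 * j : ℕ) k j =
    jacksonCoeff q β γ R (n + 2 * j : ℕ) j * (ultrasphericalWeight q γ (j - L) *
      (qPoch (γ ^ 2) q n * qPoch (q * q ^ ((j : ℤ) - L)) q n /
        (qPoch q q n * qPoch (γ * q * q ^ ((j : ℤ) - L)) q n))) := by
  set s : ℤ := j - L with hs
  have z1 : ∑ k ∈ Finset.range j,
      ultrasphericalWeight q γ (k - L) * jacksonTerm q β γ R (n + 2 * j : ℕ) k j = 0 :=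
    Finset.sum_eq_zero fun k hk => by
      rw [jacksonTerm_of_lt hq0 (Or.inl (by have := Finset.mem_range.mp hk; omega)), mul_zero]
  have z2 : ∑ i ∈ Finset.range j, ultrasphericalWeight q γ ((j + (n + 1 + i) : ℕ) - L) *
      jacksonTerm q β γ R (n + 2 * j : ℕ) (j + (n + 1 + i) : ℕ) j = 0 :=
    Finset.sum_eq_zero fun k hk => by
      rw [jacksonTerm_of_lt hq0 (Or.inr (by push_cast; omega)), mul_zero]
  rw [show n + 2 * j + 1 = j + (n + 1 + j) by ring, Finset.sum_range_add, Finset.sum_range_add, z1,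
    z2, zero_add, add_zero]
  have hc : q * q ^ s / γ * γ * γ = γ * q * q ^ s := by field_simp
  have Gc : QGeneric (γ * q * q ^ s) q := by
    have := Gγ.mul_zpow hq0 (1 + s)
    rwa [zpow_add₀ hq0, zpow_one, ← mul_assoc] at this
  -- With e = γ this choice gives abe = γq^{1+s}, ae = q^{1+s} and be = γ².
  have sa := sum_saalschuetzTerm (a := q * q ^ s / γ) (b := γ) hq0 hq Gγ
    (fun i => by rw [hc, ← zpow_natCast]; exact Gc i) n
  rw [hc, show q * q ^ s / γ * γ = q * q ^ s by field_simp, ← sq] at sa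
  rw [← sa, Finset.mul_sum, Finset.mul_sum]
  refine Finset.sum_congr rfl fun i _ => ?_
  have e1 : ((j + i : ℕ) : ℤ) - L = s + i := by rw [hs]; push_cast; ring
  have e2 : ((j + i : ℕ) : ℤ) - j = i := by push_cast; ring
  have e3 : ((n + 2 * j : ℕ) : ℤ) - (j + i : ℕ) - j = n - i := by push_cast; ring
  have g := Gγ.qPoch_ne_zero hq0 i
  rw [e1, ultrasphericalWeight_add hq0 hγ Gγ, jacksonTerm, e2, e3, saalschuetzTerm, hc]
  simp only [div_eq_mul_inv, mul_inv]
  ring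

/-- The coefficient of `z^L` in the finite identity behind the theorem, for generic parameters. -/
theorem finite_identity_of_generic (hq0 : q ≠ 0) (hq : ‖q‖ < 1) (hβ : β ≠ 0) (hγ : γ ≠ 0)
    (hρ : ρ ≠ 0) (Gβ : QGeneric β q) (Gγ : QGeneric γ q) (Gρ : QGeneric ρ q)
    (Gx : QGeneric (β * ρ / γ) q) (m M : ℕ) (L : ℤ) (hM : (M : ℤ) = m + 2 * L) :
    ∑ k ∈ Finset.range (M + 1), bilateralCoeff q β γ ρ m (L - k) *
      (qPoch β q k * qPoch β q (M - k) * ((qPoch q q k)⁻¹ * (qPoch q q (M - k))⁻¹)) =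
    ∑ s ∈ Finset.range (m / 2 + 1), rhsCoeff q β γ ρ m s * (q / β ^ 2) ^ s *
      if 0 ≤ L + s then
        qHypTerm (upperParams q β γ ρ m s) (lowerParams q β γ ρ m s) q 1 (L + s).toNat
      else 0 := by
  set PL := qPoch ρ q L * qPoch (γ * q ^ (1 + m) / (β * ρ)) q L /
      (qPoch (q ^ (1 + m) / ρ) q L * qPoch (β * ρ / γ) q L) * (β / γ) ^ L with hPL
  have h1 : ∀ k ∈ Finset.range (M + 1), bilateralCoeff q β γ ρ m (L - k) *
      (qPoch β q k * qPoch β q (M - k) * ((qPoch q q k)⁻¹ * (qPoch q q (M - k))⁻¹)) =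
      ∑ j ∈ Finset.range (M + 1), PL * (ultrasphericalWeight q γ (k - L) *
        jacksonTerm q β γ (ρ * q ^ L) M k j) := by
    intro k hk
    rw [bilateralCoeff_sub_mul hq0 hq hβ hγ hρ Gβ Gγ Gρ Gx m k L M hM, ← hPL, ← Finset.mul_sum,
      ← Finset.mul_sum]
    congr 2
    refine Finset.sum_subset (fun i hi => ?_) (fun j _ hj => ?_)
    · simp only [Finset.mem_range] at *; omega
    · simp only [Finset.mem_range] at *
      exact jacksonTerm_of_lt hq0 (Or.inl (by omega))
  rw [Finset.sum_congr rfl h1, Finset.sum_comm]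
  -- The surviving j are those with s = j - L ≥ 0 and 2s ≤ m, because M - 2j = m - 2s.
  have h2 : ∀ j ∈ Finset.range (M + 1), ∑ k ∈ Finset.range (M + 1),
      PL * (ultrasphericalWeight q γ (k - L) * jacksonTerm q β γ (ρ * q ^ L) M k j) ≠ 0 →
      L ≤ j ∧ 2 * j ≤ M := by
    intro j hj hne
    by_contra hcon
    apply hne
    rw [← Finset.mul_sum]
    rcases Nat.lt_or_ge M (2 * j) with h | h
    · rw [Finset.sum_eq_zero, mul_zero]
      intro k _
      rw [jacksonTerm_of_lt hq0 (by omega), mul_zero]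
    · have hjL : j < L := by omega
      obtain ⟨n, rfl⟩ : ∃ n, M = n + 2 * j := ⟨M - 2 * j, by omega⟩
      rw [sum_ultrasphericalWeight_mul_jacksonTerm hq0 hq hγ Gγ]
      -- The factor of index L - j - 1 is 1 - q^0; it is present because n = m + 2(L - j).
      have : qPoch (q * q ^ ((j : ℤ) - L)) q n = 0 := by
        rw [qPoch_natCast, Finset.prod_eq_zero_iff]
        refine ⟨(L - j - 1).toNat, Finset.mem_range.mpr (by push_cast at hM; omega), ?_⟩
        rw [← zpow_natCast, Int.toNat_of_nonneg (by omega), mul_assoc, ← zpow_add₀ hq0,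
          ← zpow_one_add₀ hq0, show 1 + ((j : ℤ) - L + (L - j - 1)) = 0 by ring, zpow_zero,
          sub_self]
      rw [this]
      simp
  simp only [mul_ite, mul_zero]
  rw [← Finset.sum_filter_of_ne h2, ← Finset.sum_filter]
  refine Finset.sum_nbij' (fun j => (j - L).toNat) (fun s => (L + s).toNat) ?_ ?_ ?_ ?_ ?_
  · intro j hj
    simp only [Finset.mem_filter, Finset.mem_range] at *
    omega
  · intro j hj
    simp only [Finset.mem_filter, Finset.mem_range] at *
    omega
  · intro j hj
    simp only [Finset.mem_filter, Finset.mem_range] at *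
    omega
  · intro j hj
    simp only [Finset.mem_filter, Finset.mem_range] at *
    omega
  · intro j hj
    simp only [Finset.mem_filter, Finset.mem_range] at hj
    obtain ⟨n, rfl⟩ : ∃ n, M = n + 2 * j := ⟨M - 2 * j, by omega⟩
    obtain ⟨s, hs⟩ : ∃ s : ℕ, (s : ℤ) = j - L := ⟨(j - L).toNat, by omega⟩
    have hm : m = n + 2 * s := by push_cast at hM; omega
    subst hm
    rw [← Finset.mul_sum, sum_ultrasphericalWeight_mul_jacksonTerm hq0 hq hγ Gγ, ← hs,
      Int.toNat_natCast, show (L + (s : ℤ)).toNat = j by omega,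
      rhsCoeff_mul_qHypTerm hq0 hq hβ hγ hρ Gρ Gx n s j L (n + 2 * j : ℕ) (by omega) hM, ← hPL,
      ultrasphericalWeight, zpow_natCast, zpow_natCast]
    ring

end Finite

/-! ### Continuity in the parameters and removal of genericity. -/

open Filter Topology

section Continuity

variable {q x₀ : ℂ} {f b g r : ℂ → ℂ}

theorem continuousAt_qPoch (hf : ContinuousAt f x₀) (n : ℤ)
    (h : 0 ≤ n ∨ ∀ j : ℕ, f x₀ ≠ q ^ (j + 1)) : ContinuousAt (fun u => qPoch (f u) q n) x₀ := by
  unfold qPoch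
  refine ContinuousAt.div (by fun_prop) (by fun_prop) ?_
  rw [Finset.prod_ne_zero_iff]
  intro j hj
  have hj' := Finset.mem_range.mp hj
  have h' := (h.resolve_left (by omega)) j
  rcases eq_or_ne (q ^ (j + 1)) 0 with h0 | h0
  · simp [h0]
  · rw [sub_ne_zero, ne_comm, Ne, div_eq_one_iff_eq h0]
    exact h'

theorem continuousAt_inv_qPoch (hf : ContinuousAt f x₀) (n : ℤ)
    (h : ∀ j : ℕ, f x₀ * q ^ j ≠ 1) : ContinuousAt (fun u => (qPoch (f u) q n)⁻¹) x₀ := by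
  simp only [qPoch, inv_div]
  refine ContinuousAt.div (by fun_prop) (by fun_prop) ?_
  rw [Finset.prod_ne_zero_iff]
  intro j _
  exact sub_ne_zero.mpr (h j).symm

variable (hq0 : q ≠ 0) (hq : ‖q‖ < 1) (hb : ContinuousAt b x₀) (hg : ContinuousAt g x₀)
  (hr : ContinuousAt r x₀) (hb0 : b x₀ ≠ 0) (hg0 : g x₀ ≠ 0) (hr0 : r x₀ ≠ 0) (m : ℕ)
  (hγ : ∀ j : ℕ, g x₀ * q ^ j ≠ 1) (hρ : ∀ j : ℕ, r x₀ ≠ q ^ (j + 1))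
  (hx : ∀ j : ℕ, b x₀ * r x₀ / g x₀ * q ^ j ≠ q ^ m)

include hq0 hb hg hr hb0 hg0 hr0 hγ hρ hx in
-- Numerator factorials can have poles only for n < 0 and reciprocals of denominator factorials only
-- for n ≥ 0; the three nonvanishing hypotheses exclude both kinds.
theorem continuousAt_bilateralCoeff (n : ℤ) :
    ContinuousAt (fun u => bilateralCoeff q (b u) (g u) (r u) m n) x₀ := by
  have hbr := mul_ne_zero hb0 hr0
  simp only [bilateralCoeff, qPochs, List.map_cons, List.map_nil, List.prod_cons, List.prod_nil,
    mul_one, div_eq_mul_inv _ (qPoch _ _ _ * _), mul_inv (qPoch _ _ _)]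
  refine ((((continuousAt_qPoch (by fun_prop (disch := assumption)) n (Or.inr ?_)).mul
    ((continuousAt_qPoch (by fun_prop (disch := assumption)) n (Or.inr ?_)).mul
    (continuousAt_qPoch (by fun_prop (disch := assumption)) n (Or.inr ?_)))).mul
    ((continuousAt_inv_qPoch (by fun_prop (disch := assumption)) n ?_).mul
    ((continuousAt_inv_qPoch (by fun_prop (disch := assumption)) n ?_).mul
    (continuousAt_inv_qPoch (by fun_prop (disch := assumption)) n ?_))))).mul
    (hb.zpow₀ n (Or.inl hb0))
  · intro j h
    apply hγ (j + 1)
    rw [← h]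
    field_simp
  · exact hρ
  · intro j h
    apply hx j
    rw [div_eq_iff hbr] at h
    rw [pow_add, pow_one, pow_succ] at h
    rw [div_mul_eq_mul_div, div_eq_iff hg0]
    refine mul_right_cancel₀ hq0 ?_
    linear_combination -h
  · exact hγ
  · intro j h
    apply hρ (m + j)
    rw [div_mul_eq_mul_div, div_eq_one_iff_eq hr0] at h
    rw [← h]
    ring
  · intro j h
    apply hx (j + m)
    rw [pow_add, ← mul_assoc, h, one_mul]

theorem qHypTerm_four (a₁ a₂ a₃ a₄ b₁ b₂ b₃ z : ℂ) (k : ℕ) :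
    qHypTerm [a₁, a₂, a₃, a₄] [b₁, b₂, b₃] q z k =
      qPoch a₁ q k * (qPoch a₂ q k * (qPoch a₃ q k * qPoch a₄ q k)) *
        ((qPoch q q k)⁻¹ * ((qPoch b₁ q k)⁻¹ * ((qPoch b₂ q k)⁻¹ * (qPoch b₃ q k)⁻¹))) * z ^ k := by
  simp only [qHypTerm, qPochs, List.map_cons, List.map_nil, List.prod_cons, List.prod_nil,
    mul_one, div_eq_mul_inv, mul_inv]

include hq0 in
theorem lowerParams_ne {β γ ρ : ℂ} (hρ0 : ρ ≠ 0) (hγ : ∀ j : ℕ, γ * q ^ j ≠ 1)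
    (hρ : ∀ j : ℕ, ρ ≠ q ^ (j + 1)) (hx : ∀ j : ℕ, β * ρ / γ * q ^ j ≠ q ^ m) {s : ℕ}
    (hs : 2 * s ≤ m) (j : ℕ) :
    γ * q ^ (1 + (m : ℤ) - 2 * s) * q ^ j ≠ 1 ∧ β * ρ * q ^ (-(s : ℤ)) / γ * q ^ j ≠ 1 ∧
      q ^ (1 + (m : ℤ) - s) / ρ * q ^ j ≠ 1 := by
  refine ⟨fun h => ?_, fun h => ?_, fun h => ?_⟩
  · apply hγ (1 + m - 2 * s + j)
    rw [← h, ← zpow_natCast, ← zpow_natCast, mul_assoc, ← zpow_add₀ hq0]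
    congr 2
    omega
  · apply hx (j + (m - s))
    have e : q ^ m = q ^ (m - s) * q ^ s := by rw [← pow_add]; congr 1; omega
    have hs0 : q ^ s ≠ 0 := pow_ne_zero _ hq0
    calc β * ρ / γ * q ^ (j + (m - s))
        = (β * ρ * q ^ (-(s : ℤ)) / γ * q ^ j) * (q ^ (m - s) * q ^ s) := by
          rw [zpow_neg, zpow_natCast, pow_add]; field_simp
      _ = q ^ m := by rw [h, one_mul, e]
  · apply hρ (m - s + j)
    rw [div_mul_eq_mul_div, div_eq_one_iff_eq hρ0] at h
    rw [← h, ← zpow_natCast, ← zpow_natCast, ← zpow_add₀ hq0]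
    congr 1
    omega

include hq0 hb hg hr hg0 hr0 hγ hρ hx in
theorem continuousAt_qHypTerm_params {s : ℕ} (hs : 2 * s ≤ m) (k : ℕ) :
    ContinuousAt (fun u => qHypTerm (upperParams q (b u) (g u) (r u) m s)
      (lowerParams q (b u) (g u) (r u) m s) q 1 k) x₀ := by
  have hk : (0 : ℤ) ≤ k := Int.natCast_nonneg k
  have hl := lowerParams_ne hq0 m hr0 hγ hρ hx hs
  simp only [upperParams, lowerParams, qHypTerm_four]
  refine ((ContinuousAt.mul ?_ (ContinuousAt.mul ?_ (ContinuousAt.mul ?_ ?_))).mul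
    (continuousAt_const.mul (ContinuousAt.mul ?_ (ContinuousAt.mul ?_ ?_)))).mul continuousAt_const
  · exact continuousAt_qPoch (by fun_prop (disch := assumption)) _ (Or.inl hk)
  · exact continuousAt_qPoch (by fun_prop (disch := assumption)) _ (Or.inl hk)
  · exact continuousAt_qPoch (by fun_prop (disch := assumption)) _ (Or.inl hk)
  · exact continuousAt_qPoch (by fun_prop (disch := assumption)) _ (Or.inl hk)
  · exact continuousAt_inv_qPoch (by fun_prop (disch := assumption)) _ fun j => (hl j).1
  · exact continuousAt_inv_qPoch (by fun_prop (disch := assumption)) _ fun j => (hl j).2.1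
  · exact continuousAt_inv_qPoch (by fun_prop (disch := assumption)) _ fun j => (hl j).2.2

include hq0 hb hg hr hb0 hg0 hr0 hγ hρ hx in
theorem continuousAt_rhsCoeff {s : ℕ} (hs : 2 * s ≤ m) :
    ContinuousAt (fun u => rhsCoeff q (b u) (g u) (r u) m s) x₀ := by
  have hk : (0 : ℤ) ≤ s := Int.natCast_nonneg s
  have hn : (0 : ℤ) ≤ (m : ℤ) - 2 * s := by omega
  have hbr := mul_ne_zero hb0 hr0
  have hγ' : ∀ j : ℕ, g x₀ * q * q ^ j ≠ 1 := fun j => by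
    rw [mul_assoc, ← pow_succ']; exact hγ _
  simp only [rhsCoeff, qPochs, List.map_cons, List.map_nil, List.prod_cons, List.prod_nil,
    mul_one, div_eq_mul_inv _ (qPoch _ _ _ * _), mul_inv (qPoch _ _ _),
    div_eq_mul_inv _ (qPoch _ _ _)]
  refine ((((ContinuousAt.mul (by fun_prop) (ContinuousAt.mul (ContinuousAt.mul ?_
    (ContinuousAt.mul ?_ ?_)) (continuousAt_const.mul (ContinuousAt.mul ?_ ?_)))).mul ?_)).mul
    ((ContinuousAt.mul ?_ ?_).mul (continuousAt_const.mul ?_))).mul (continuousAt_const.mul ?_)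
  · exact continuousAt_qPoch (by fun_prop (disch := assumption)) _ (Or.inl hk)
  · exact continuousAt_qPoch (by fun_prop (disch := assumption)) _ (Or.inl hk)
  · exact continuousAt_qPoch (by fun_prop (disch := assumption)) _ (Or.inl hk)
  · refine continuousAt_inv_qPoch (by fun_prop (disch := assumption)) _ fun j h => hρ j ?_
    rw [div_mul_eq_mul_div, div_eq_one_iff_eq hr0] at h
    rw [← h]
    ring
  · refine continuousAt_inv_qPoch (by fun_prop (disch := assumption)) _ fun j h => hx j ?_
    have hqm : q ^ m ≠ 0 := pow_ne_zero _ hq0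
    rw [zpow_neg, zpow_natCast] at h
    field_simp at h
    rw [div_mul_eq_mul_div, div_eq_iff hg0]
    linear_combination h
  · refine ContinuousAt.div (by fun_prop) (by fun_prop) (sub_ne_zero.mpr ?_)
    have := hγ 0
    rw [pow_zero, mul_one] at this
    exact this.symm
  · exact continuousAt_qPoch (by fun_prop (disch := assumption)) _ (Or.inl hn)
  · exact continuousAt_qPoch (by fun_prop (disch := assumption)) _ (Or.inl hn)
  · exact continuousAt_inv_qPoch (by fun_prop (disch := assumption)) _ hγ'
  · exact continuousAt_inv_qPoch (by fun_prop (disch := assumption)) _ hγ'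

end Continuity

section Finite

variable {q β γ ρ : ℂ}

theorem countable_not_qGeneric_mul (q : ℂ) {c : ℂ} :
    {u : ℂ | ¬ QGeneric (u * c) q}.Countable := by
  refine (Set.countable_range fun k : ℤ => (c * q ^ k)⁻¹).mono fun u hu => ?_
  simp only [QGeneric, Set.mem_ofPred_eq, not_forall, not_not] at hu
  obtain ⟨k, hk⟩ := hu
  exact ⟨k, (eq_inv_of_mul_eq_one_left (by rw [← mul_assoc]; exact hk)).symm⟩

/-- The coefficient of `z^L` in the finite identity behind the theorem. -/
theorem finite_identity (hq0 : q ≠ 0) (hq : ‖q‖ < 1) (hβ : β ≠ 0) (hγ : γ ≠ 0)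
    (hρ : ρ ≠ 0) (m M : ℕ) (L : ℤ) (hM : (M : ℤ) = m + 2 * L)
    (hγq : ∀ j : ℕ, γ * q ^ j ≠ 1) (hρq : ∀ j : ℕ, ρ ≠ q ^ (j + 1))
    (hx : ∀ j : ℕ, β * ρ / γ * q ^ j ≠ q ^ m) :
    ∑ k ∈ Finset.range (M + 1), bilateralCoeff q β γ ρ m (L - k) *
      (qPoch β q k * qPoch β q (M - k) * ((qPoch q q k)⁻¹ * (qPoch q q (M - k))⁻¹)) =
    ∑ s ∈ Finset.range (m / 2 + 1), rhsCoeff q β γ ρ m s * (q / β ^ 2) ^ s *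
      if 0 ≤ L + s then
        qHypTerm (upperParams q β γ ρ m s) (lowerParams q β γ ρ m s) q 1 (L + s).toNat
      else 0 := by
  -- Under the common scaling βρ/γ is also multiplied by u, so each genericity condition excludes
  -- only countably many u, and 1 is a limit of admissible ones.
  set S : Set ℂ := {u | u ≠ 0 ∧ QGeneric (u * β) q ∧ QGeneric (u * γ) q ∧ QGeneric (u * ρ) q ∧
    QGeneric (u * (β * ρ / γ)) q} with hS
  have hSc : Sᶜ.Countable := by
    refine (((((Set.countable_singleton (0 : ℂ)).union (countable_not_qGeneric_mul q (c := β))).union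
      (countable_not_qGeneric_mul q (c := γ))).union
      (countable_not_qGeneric_mul q (c := ρ))).union
      (countable_not_qGeneric_mul q (c := β * ρ / γ))).mono fun u hu => ?_
    simp only [hS, Set.mem_compl_iff, Set.mem_ofPred_eq, Set.mem_union, Set.mem_singleton_iff] at *
    tauto
  have hdense : Dense S := by
    have := hSc.dense_compl ℂ
    rwa [compl_compl] at this
  have hne : (𝓝[S] (1 : ℂ)).NeBot := mem_closure_iff_nhdsWithin_neBot.mp (hdense 1)
  have cb : ContinuousAt (fun u : ℂ => u * β) 1 := by fun_prop
  have cg : ContinuousAt (fun u : ℂ => u * γ) 1 := by fun_prop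
  have cr : ContinuousAt (fun u : ℂ => u * ρ) 1 := by fun_prop
  have hb0 : (fun u : ℂ => u * β) 1 ≠ 0 := by simpa
  have hg0 : (fun u : ℂ => u * γ) 1 ≠ 0 := by simpa
  have hr0 : (fun u : ℂ => u * ρ) 1 ≠ 0 := by simpa
  have hγ1 : ∀ j : ℕ, (fun u : ℂ => u * γ) 1 * q ^ j ≠ 1 := by simpa using hγq
  have hρ1 : ∀ j : ℕ, (fun u : ℂ => u * ρ) 1 ≠ q ^ (j + 1) := by simpa using hρq
  have hx1 : ∀ j : ℕ, (fun u : ℂ => u * β) 1 * (fun u : ℂ => u * ρ) 1 /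
      (fun u : ℂ => u * γ) 1 * q ^ j ≠ q ^ m := by simpa using hx
  have lhs : ContinuousAt (fun u : ℂ => ∑ k ∈ Finset.range (M + 1),
      bilateralCoeff q (u * β) (u * γ) (u * ρ) m (L - k) * (qPoch (u * β) q k *
        qPoch (u * β) q (M - k) * ((qPoch q q k)⁻¹ * (qPoch q q (M - k))⁻¹))) 1 := by
    refine tendsto_finsetSum _ fun k hk => ContinuousAt.mul
      (continuousAt_bilateralCoeff hq0 cb cg cr hb0 hg0 hr0 m hγ1 hρ1 hx1 (L - k))
      (((continuousAt_qPoch cb k (Or.inl (Int.natCast_nonneg k))).mul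
        (continuousAt_qPoch cb _ (Or.inl ?_))).mul continuousAt_const)
    have := Finset.mem_range.mp hk
    omega
  have rhs : ContinuousAt (fun u : ℂ => ∑ s ∈ Finset.range (m / 2 + 1),
      rhsCoeff q (u * β) (u * γ) (u * ρ) m s * (q / (u * β) ^ 2) ^ s *
      if 0 ≤ L + s then
        qHypTerm (upperParams q (u * β) (u * γ) (u * ρ) m s)
          (lowerParams q (u * β) (u * γ) (u * ρ) m s) q 1 (L + s).toNat
      else 0) 1 := by
    refine tendsto_finsetSum _ fun s hs => ?_
    have hs' : 2 * s ≤ m := by have := Finset.mem_range.mp hs; omega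
    refine ContinuousAt.mul (ContinuousAt.mul
      (continuousAt_rhsCoeff hq0 cb cg cr hb0 hg0 hr0 m hγ1 hρ1 hx1 hs') ?_) ?_
    · exact (continuousAt_const.div (cb.pow 2) (pow_ne_zero _ hb0)).pow s
    · split_ifs
      · exact continuousAt_qHypTerm_params hq0 cb cg cr hg0 hr0 m hγ1 hρ1 hx1 hs' _
      · exact continuousAt_const
  have l1 := lhs.tendsto.mono_left (nhdsWithin_le_nhds (s := S))
  have r1 := rhs.tendsto.mono_left (nhdsWithin_le_nhds (s := S))
  have heq := tendsto_nhds_unique_of_eventuallyEq l1 r1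
    (eventually_nhdsWithin_of_forall fun u hu => by
      obtain ⟨hu0, h1, h2, h3, h4⟩ := hu
      refine finite_identity_of_generic hq0 hq (mul_ne_zero hu0 hβ) (mul_ne_zero hu0 hγ)
        (mul_ne_zero hu0 hρ) h1 h2 h3 ?_ m M L hM
      rwa [show u * β * (u * ρ) / (u * γ) = u * (β * ρ / γ) by field_simp])
  simpa only [one_mul] using heq

end Finite

/-! ### The q-Gauss sum. -/

section Gauss

variable {q : ℂ}

theorem tendsto_qPoch_natCast (hq : ‖q‖ < 1) (a : ℂ) :
    Tendsto (fun n : ℕ => qPoch a q n) atTop (𝓝 (qPochInf a q)) := by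
  simp only [qPoch_natCast]
  exact (qPochInf_multipliable a hq).tendsto_prod_tprod_nat

theorem qPochInf_ne_zero (hq : ‖q‖ < 1) {a : ℂ} (h : ∀ j : ℕ, a * q ^ j ≠ 1) :
    qPochInf a q ≠ 0 := by
  have hs : Summable fun j : ℕ => ‖-(a * q ^ j)‖ := by
    simp only [norm_neg, norm_mul, norm_pow]
    exact (summable_geometric_of_lt_one (norm_nonneg q) hq).mul_left _
  have := tprod_one_add_ne_zero_of_summable (f := fun j : ℕ => -(a * q ^ j))
    (fun j => by rw [← sub_eq_add_neg]; exact sub_ne_zero.mpr (h j).symm) hs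
  simpa only [qPochInf, sub_eq_add_neg] using this

theorem exists_norm_qPoch_le (hq : ‖q‖ < 1) (a : ℂ) :
    ∃ C : ℝ, 0 < C ∧ ∀ n : ℕ, ‖qPoch a q n‖ ≤ C := by
  obtain ⟨C, hC⟩ := (tendsto_qPoch_natCast hq a).norm.bddAbove_range
  exact ⟨max C 1, by positivity, fun n => (hC ⟨n, rfl⟩).trans (le_max_left _ _)⟩

theorem exists_norm_inv_qPoch_le (hq : ‖q‖ < 1) {a : ℂ} (h : ∀ j : ℕ, a * q ^ j ≠ 1) :
    ∃ C : ℝ, 0 < C ∧ ∀ n : ℕ, ‖(qPoch a q n)⁻¹‖ ≤ C := by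
  obtain ⟨C, hC⟩ := ((tendsto_qPoch_natCast hq a).inv₀ (qPochInf_ne_zero hq h)).norm.bddAbove_range
  exact ⟨max C 1, by positivity, fun n => (hC ⟨n, rfl⟩).trans (le_max_left _ _)⟩

theorem mul_pow_ne_one_of_norm_lt_one (hq : ‖q‖ < 1) {a : ℂ} (ha : ‖a‖ < 1) (j : ℕ) :
    a * q ^ j ≠ 1 := by
  intro h
  have h1 : ‖a‖ * ‖q‖ ^ j = 1 := by rw [← norm_pow, ← norm_mul, h, norm_one]
  have h2 : ‖q‖ ^ j ≤ 1 := pow_le_one₀ (norm_nonneg _) hq.le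
  nlinarith [norm_nonneg a]

theorem self_mul_pow_ne_one (hq : ‖q‖ < 1) (j : ℕ) : q * q ^ j ≠ 1 :=
  mul_pow_ne_one_of_norm_lt_one hq hq j

/-- The summand of the `q`-Gauss sum `₂φ₁(a, b; abe; q, e)`. -/
noncomputable def gaussTerm (q a b e : ℂ) (k : ℕ) : ℂ :=
  qPoch a q k * qPoch b q k * ((qPoch q q k)⁻¹ * (qPoch (a * b * e) q k)⁻¹) * e ^ k

variable {a b e : ℂ}

/-- The constant is uniform in n because 1/(abeq^n)_k = (abe)_n/(abe)_{n+k}, with both factors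
bounded. Uniformity is needed for dominated convergence in `tsum_gaussTerm`. -/
theorem exists_norm_gaussTerm_le (hq : ‖q‖ < 1) (hc : ∀ j : ℕ, a * b * e * q ^ j ≠ 1) :
    ∃ C : ℝ, ∀ n k : ℕ, ‖gaussTerm q a b (e * q ^ n) k‖ ≤ C * ‖e * q ^ n‖ ^ k := by
  obtain ⟨C₁, p₁, h₁⟩ := exists_norm_qPoch_le hq a
  obtain ⟨C₂, p₂, h₂⟩ := exists_norm_qPoch_le hq b
  obtain ⟨C₃, p₃, h₃⟩ := exists_norm_inv_qPoch_le hq (self_mul_pow_ne_one hq)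
  obtain ⟨C₄, p₄, h₄⟩ := exists_norm_inv_qPoch_le hq hc
  obtain ⟨C₅, p₅, h₅⟩ := exists_norm_qPoch_le hq (a * b * e)
  refine ⟨C₁ * C₂ * (C₃ * (C₅ * C₄)), fun n k => ?_⟩
  have e1 : (qPoch (a * b * (e * q ^ n)) q k)⁻¹ =
      qPoch (a * b * e) q n * (qPoch (a * b * e) q (n + k : ℕ))⁻¹ := by
    have := qPoch_natCast_ne_zero n fun j _ => hc j
    rw [qPoch_natCast_add, mul_inv, mul_inv_cancel_left₀ this, mul_assoc (a * b)]
  rw [gaussTerm, e1, norm_mul, norm_mul, norm_mul, norm_mul, norm_mul, norm_pow]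
  gcongr
  · exact h₁ k
  · exact h₂ k
  · exact h₃ k
  · exact h₅ n
  · exact h₄ _

theorem summable_gaussTerm (hq : ‖q‖ < 1) (hc : ∀ j : ℕ, a * b * e * q ^ j ≠ 1) (he : ‖e‖ < 1) :
    Summable (gaussTerm q a b e) := by
  obtain ⟨C, hC⟩ := exists_norm_gaussTerm_le hq hc
  refine Summable.of_norm_bounded (g := fun k => C * ‖e‖ ^ k)
    ((summable_geometric_of_lt_one (norm_nonneg e) he).mul_left C) fun k => ?_
  simpa using hC 0 k

/-- Telescopes the contiguous relation e → eq with a, b fixed; the boundary terms vanish at k = 0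
and as k → ∞. -/
theorem gaussTerm_certificate (hq : ‖q‖ < 1) (hc : ∀ j : ℕ, a * b * e * q ^ j ≠ 1)
    (k : ℕ) :
    (1 - e) * (1 - a * b * e) * gaussTerm q a b e k -
      (1 - b * e) * (1 - a * e) * gaussTerm q a b (e * q) k =
    -((1 - a * b * e) * (1 - q ^ (k + 1)) * gaussTerm q a b e (k + 1)) -
      -((1 - a * b * e) * (1 - q ^ k) * gaussTerm q a b e k) := by
  have a1 := qPoch_natCast_succ a q k
  have a2 := qPoch_natCast_succ b q k
  have b1 := qPoch_natCast_succ q q k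
  have b2 := qPoch_natCast_succ (a * b * e) q k
  have b3 := qPoch_natCast_add (a * b * e) q 1 k
  rw [Nat.add_comm, b2, qPoch_natCast _ _ 1] at b3
  simp only [Finset.range_one, Finset.prod_singleton, pow_zero, mul_one, pow_one] at b3
  have c1 := qPoch_natCast_ne_zero k fun j _ => self_mul_pow_ne_one hq j
  have c2 := qPoch_natCast_ne_zero k fun j _ => hc j
  have n1 : 1 - q * q ^ k ≠ 0 := sub_ne_zero.mpr (self_mul_pow_ne_one hq k).symm
  have n2 : 1 - a * b * e * q ^ k ≠ 0 := sub_ne_zero.mpr (hc k).symm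
  have n3 : 1 - a * b * e ≠ 0 := by
    have := hc 0
    rw [pow_zero, mul_one] at this
    exact sub_ne_zero.mpr this.symm
  have b4 : (qPoch (a * b * (e * q)) q k)⁻¹ =
      (1 - a * b * e) * ((qPoch (a * b * e) q k)⁻¹ * (1 - a * b * e * q ^ k)⁻¹) := by
    rw [← mul_inv, b3, mul_inv, mul_inv_cancel_left₀ n3, mul_assoc (a * b)]
  unfold gaussTerm
  rw [a1, a2, b1, b2, b4, pow_succ' q k, mul_inv, mul_inv, mul_pow, pow_succ e k]
  generalize (qPoch q q k)⁻¹ = C at *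
  generalize (qPoch (a * b * e) q k)⁻¹ = D at *
  generalize qPoch a q k = A at *
  generalize qPoch b q k = B at *
  generalize e ^ k = P at *
  generalize q ^ k = y at *
  have i1 : (1 - q * y)⁻¹ * (1 - q * y) = 1 := inv_mul_cancel₀ n1
  have i2 : (1 - a * b * e * y)⁻¹ * (1 - a * b * e * y) = 1 := inv_mul_cancel₀ n2
  generalize (1 - q * y)⁻¹ = N at *
  generalize (1 - a * b * e * y)⁻¹ = T at *
  linear_combination (1 - a * b * e) * A * B * C * D * P * ((1 - a * y) * (1 - b * y) * e * T * i1 -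
    ((1 - e) - (1 - y)) * i2)

theorem tsum_gaussTerm_mul (hq : ‖q‖ < 1) (hc : ∀ j : ℕ, a * b * e * q ^ j ≠ 1)
    (he : ‖e‖ < 1) :
    (1 - e) * (1 - a * b * e) * ∑' k, gaussTerm q a b e k =
      (1 - b * e) * (1 - a * e) * ∑' k, gaussTerm q a b (e * q) k := by
  have s1 := summable_gaussTerm hq hc he
  have hc' : ∀ j : ℕ, a * b * (e * q) * q ^ j ≠ 1 := fun j => by
    have := hc (j + 1)
    rwa [pow_succ', ← mul_assoc, mul_assoc (a * b)] at this
  have he' : ‖e * q‖ < 1 := by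
    rw [norm_mul]
    nlinarith [norm_nonneg e, norm_nonneg q]
  have s2 := summable_gaussTerm hq hc' he'
  set G : ℕ → ℂ := fun k => -((1 - a * b * e) * (1 - q ^ k) * gaussTerm q a b e k) with hG
  have h0 : Tendsto G atTop (𝓝 (-((1 - a * b * e) * (1 - 0) * 0))) :=
    ((tendsto_const_nhds.mul (tendsto_const_nhds.sub
      (tendsto_pow_atTop_nhds_zero_of_norm_lt_one hq))).mul s1.tendsto_atTop_zero).neg
  have hs := ((s1.mul_left ((1 - e) * (1 - a * b * e))).sub
    (s2.mul_left ((1 - b * e) * (1 - a * e)))).hasSum.tendsto_sum_nat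
  have hsum : ∀ n, ∑ k ∈ Finset.range n, ((1 - e) * (1 - a * b * e) * gaussTerm q a b e k -
      (1 - b * e) * (1 - a * e) * gaussTerm q a b (e * q) k) = G n - G 0 := fun n => by
    rw [← Finset.sum_range_sub]
    exact Finset.sum_congr rfl fun k _ => gaussTerm_certificate hq hc k
  simp only [hsum] at hs
  have hz := tendsto_nhds_unique hs (h0.sub_const _)
  rw [(s1.mul_left _).tsum_sub (s2.mul_left _), tsum_mul_left, tsum_mul_left, hG] at hz
  simp only [mul_zero, neg_zero, pow_zero, sub_self, zero_mul, sub_zero] at hz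
  exact sub_eq_zero.mp hz

/-- The `q`-Gauss sum. -/
theorem tsum_gaussTerm (hq : ‖q‖ < 1) (hc : ∀ j : ℕ, a * b * e * q ^ j ≠ 1) (he : ‖e‖ < 1) :
    ∑' k, gaussTerm q a b e k =
      qPochInf (b * e) q * qPochInf (a * e) q / (qPochInf (a * b * e) q * qPochInf e q) := by
  have hen := mul_pow_ne_one_of_norm_lt_one hq he
  -- Iterating the contiguous relation moves e to eq^n; as n → ∞ only the term k = 0 survives, and
  -- the finite products become infinite ones.
  have shift : ∀ n : ℕ, qPoch e q n * qPoch (a * b * e) q n * ∑' k, gaussTerm q a b e k =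
      qPoch (b * e) q n * qPoch (a * e) q n * ∑' k, gaussTerm q a b (e * q ^ n) k := by
    intro n
    induction n with
    | zero => simp [qPoch_zero]
    | succ n ih =>
      have h := tsum_gaussTerm_mul (a := a) (b := b) (e := e * q ^ n) hq
        (fun j => by have := hc (n + j); rwa [pow_add, ← mul_assoc, mul_assoc (a * b)] at this)
        (by
          rw [norm_mul, norm_pow]
          have := pow_le_one₀ (n := n) (norm_nonneg q) hq.le
          nlinarith [norm_nonneg e])
      rw [qPoch_natCast_succ, qPoch_natCast_succ, qPoch_natCast_succ, qPoch_natCast_succ,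
        pow_succ, ← mul_assoc e]
      linear_combination (1 - e * q ^ n) * (1 - a * b * e * q ^ n) * ih +
        qPoch (b * e) q n * qPoch (a * e) q n * h
  have lim : Tendsto (fun n : ℕ => ∑' k, gaussTerm q a b (e * q ^ n) k) atTop
      (𝓝 (∑' k : ℕ, if k = 0 then 1 else 0)) := by
    obtain ⟨C, hC⟩ := exists_norm_gaussTerm_le hq hc
    have hC0 : 0 ≤ C := by simpa using (norm_nonneg _).trans (hC 0 0)
    have hle : ∀ n : ℕ, ‖e * q ^ n‖ ≤ ‖e‖ := fun n => by
      rw [norm_mul, norm_pow]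
      exact mul_le_of_le_one_right (norm_nonneg e) (pow_le_one₀ (norm_nonneg q) hq.le)
    refine tendsto_tsum_of_dominated_convergence (bound := fun k => C * ‖e‖ ^ k)
      ((summable_geometric_of_lt_one (norm_nonneg e) he).mul_left C) (fun k => ?_)
      (Eventually.of_forall fun n k => (hC n k).trans (by gcongr; exact hle n))
    rcases Nat.eq_zero_or_pos k with rfl | hk
    · simp [gaussTerm, qPoch_zero]
    · rw [if_neg hk.ne']
      refine squeeze_zero_norm (fun n => hC n k) ?_
      have h1 : Tendsto (fun n : ℕ => ‖e * q ^ n‖) atTop (𝓝 0) := by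
        have := ((tendsto_pow_atTop_nhds_zero_of_norm_lt_one hq).const_mul e).norm
        simpa using this
      have h2 := (h1.pow k).const_mul C
      rwa [zero_pow hk.ne', mul_zero] at h2
  rw [tsum_ite_eq] at lim
  have l1 := (((tendsto_qPoch_natCast hq e).mul (tendsto_qPoch_natCast hq (a * b * e))).mul_const
    (∑' k, gaussTerm q a b e k))
  have l2 := ((tendsto_qPoch_natCast hq (b * e)).mul (tendsto_qPoch_natCast hq (a * e))).mul lim
  simp only [← shift] at l2
  have := tendsto_nhds_unique l1 l2
  rw [eq_div_iff (mul_ne_zero (qPochInf_ne_zero hq hc) (qPochInf_ne_zero hq hen))]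
  linear_combination this

end Gauss

/-! ### The convolution form of the q-Gauss sum, for integer shifts. -/

section Bilateral

variable {q β γ ρ : ℂ}

theorem qPoch_neg_natCast_eq_inv {a : ℂ} (hq0 : q ≠ 0) (ha : a ≠ 0) (N : ℕ) :
    qPoch a q (-(N : ℤ)) =
      ((∏ j ∈ Finset.range N, -(q ^ (j + 1))⁻¹) * a ^ N * qPoch (q / a) q N)⁻¹ := by
  have h : a ^ N = ∏ _i ∈ Finset.range N, a := by simp
  rw [qPoch_neg_natCast, qPoch_natCast, h, ← Finset.prod_mul_distrib, ← Finset.prod_mul_distrib]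
  congr 1
  refine Finset.prod_congr rfl fun i _ => ?_
  have h1 : q ^ (i + 1) ≠ 0 := pow_ne_zero _ hq0
  rw [show 1 - q / a * q ^ i = (a - q ^ (i + 1)) / a by rw [pow_succ]; field_simp]
  field_simp
  ring

/-- No genericity is needed: a vanishing factor yields 0 on both sides under the convention for
division by zero. -/
theorem qPoch_neg_div_qPoch_neg {a b : ℂ} (hq0 : q ≠ 0) (ha : a ≠ 0) (hb : b ≠ 0) (N : ℕ) :
    qPoch a q (-(N : ℤ)) / qPoch b q (-(N : ℤ)) =
      (b / a) ^ N * (qPoch (q / b) q N * (qPoch (q / a) q N)⁻¹) := by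
  have h4 : (∏ i ∈ Finset.range N, -(q ^ (i + 1))⁻¹) ≠ 0 :=
    Finset.prod_ne_zero_iff.mpr fun i _ => neg_ne_zero.mpr (inv_ne_zero (pow_ne_zero _ hq0))
  rw [qPoch_neg_natCast_eq_inv hq0 ha, qPoch_neg_natCast_eq_inv hq0 hb, div_eq_mul_inv, inv_inv,
    mul_inv, mul_inv, div_pow, div_eq_mul_inv (b ^ N)]
  generalize (∏ i ∈ Finset.range N, -(q ^ (i + 1))⁻¹) = K at *
  generalize qPoch (q / a) q N = A
  generalize qPoch (q / b) q N = B
  have := inv_mul_cancel₀ h4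
  linear_combination (a ^ N)⁻¹ * A⁻¹ * b ^ N * B * this

theorem norm_div_lt_one_of_norm_div_sq (hq : ‖q‖ < 1) (hz : ‖q / β ^ 2‖ < 1) : ‖q / β‖ < 1 := by
  have h : ‖q / β‖ ^ 2 = ‖q‖ * ‖q / β ^ 2‖ := by
    rw [← norm_pow, ← norm_mul]
    congr 1
    ring
  have h2 : ‖q / β‖ ^ 2 < 1 := by
    rw [h]
    nlinarith [norm_nonneg q, norm_nonneg (q / β ^ 2)]
  exact (sq_lt_one_iff₀ (norm_nonneg _)).mp h2

/-- The constant in the `q`-Gauss evaluation `hasSum_convolution`. -/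
noncomputable def gaussConst (q β : ℂ) : ℂ :=
  qPochInf (q / β) q * qPochInf (q / β) q / (qPochInf q q * qPochInf (q / β ^ 2) q)

theorem hasSum_convolution_natCast (hq0 : q ≠ 0) (hq : ‖q‖ < 1) (hβ : β ≠ 0)
    (hz : ‖q / β ^ 2‖ < 1) (N : ℕ) :
    HasSum (fun k : ℕ => qPoch β q k * qPoch β q (k + N) *
      ((qPoch q q k)⁻¹ * (qPoch q q (k + N))⁻¹) * (q / β ^ 2) ^ k)
      (gaussConst q β * (qPoch β q N / qPoch (q / β) q N)) := by
  have hβz := norm_div_lt_one_of_norm_div_sq hq hz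
  have hqN : q ^ N ≠ 0 := pow_ne_zero _ hq0
  -- q-Gauss is applied with a = β, b = βq^N, e = q/β², for which the lower parameter abe is
  -- q^{1+N}.
  have e1 : β * (β * q ^ N) * (q / β ^ 2) = q * q ^ N := by field_simp
  have hc : ∀ j : ℕ, β * (β * q ^ N) * (q / β ^ 2) * q ^ j ≠ 1 := fun j => by
    rw [e1, mul_assoc, ← pow_add]
    exact self_mul_pow_ne_one hq _
  have hs := (summable_gaussTerm hq hc hz).hasSum
  rw [tsum_gaussTerm hq hc hz, e1, show β * q ^ N * (q / β ^ 2) = q / β * q ^ N by field_simp,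
    show β * (q / β ^ 2) = q / β by field_simp] at hs
  have hs2 := hs.mul_left (qPoch β q N * (qPoch q q N)⁻¹)
  have i1 := qPochInf_split (q / β) hq N
  have i2 := qPochInf_split q hq N
  rw [← qPoch_natCast] at i1 i2
  have n1 := qPoch_natCast_ne_zero N fun j _ => mul_pow_ne_one_of_norm_lt_one hq hβz j
  have n2 := qPoch_natCast_ne_zero N fun j _ => self_mul_pow_ne_one hq j
  have n3 : qPochInf (q * q ^ N) q ≠ 0 := qPochInf_ne_zero hq fun j => by
    rw [mul_assoc, ← pow_add]
    exact self_mul_pow_ne_one hq _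
  have n4 := qPochInf_ne_zero hq (mul_pow_ne_one_of_norm_lt_one hq hz)
  have hval : gaussConst q β * (qPoch β q N / qPoch (q / β) q N) =
      qPoch β q N * (qPoch q q N)⁻¹ * (qPochInf (q / β * q ^ N) q * qPochInf (q / β) q /
        (qPochInf (q * q ^ N) q * qPochInf (q / β ^ 2) q)) := by
    rw [gaussConst, i2]
    nth_rw 1 [i1]
    field_simp
  rw [hval]
  suffices hf : _ = _ from Eq.mpr (congrArg (fun f : ℕ → ℂ => HasSum f _) hf) hs2
  · funext k
    have a1 := qPoch_natCast_add β q N k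
    have a2 := qPoch_natCast_add q q N k
    rw [← Nat.cast_add, Nat.add_comm k N, a1, a2, gaussTerm, e1, mul_inv]
    ring

theorem hasSum_convolution (hq0 : q ≠ 0) (hq : ‖q‖ < 1) (hβ : β ≠ 0)
    (hz : ‖q / β ^ 2‖ < 1) (N : ℤ) :
    HasSum (fun k : ℕ => qPoch β q k * qPoch β q (k + N) *
      ((qPoch q q k)⁻¹ * (qPoch q q (k + N))⁻¹) * (q / β ^ 2) ^ k)
      (gaussConst q β * (qPoch β q N / qPoch (q / β) q N)) := by
  obtain ⟨n, rfl | rfl⟩ := Int.eq_nat_or_neg N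
  · exact hasSum_convolution_natCast hq0 hq hβ hz n
  -- For N = -n the first n terms vanish and the shift k → k + n interchanges the two factorials,
  -- reducing to N = n; reflection absorbs the extra power of q/β².
  · have h := (hasSum_convolution_natCast hq0 hq hβ hz n).mul_left ((q / β ^ 2) ^ n)
    have hz0 : ∑ k ∈ Finset.range n, qPoch β q k * qPoch β q (k + -(n : ℤ)) *
      ((qPoch q q k)⁻¹ * (qPoch q q (k + -(n : ℤ)))⁻¹) * (q / β ^ 2) ^ k = 0 :=
      Finset.sum_eq_zero fun k hk => by
        rw [qPoch_self_of_neg hq0 (show (k : ℤ) + -n < 0 by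
          have := Finset.mem_range.mp hk; omega)]
        simp
    rw [← hasSum_nat_add_iff' n, hz0, sub_zero]
    have hval : gaussConst q β * (qPoch β q (-(n : ℤ)) / qPoch (q / β) q (-(n : ℤ))) =
        (q / β ^ 2) ^ n * (gaussConst q β * (qPoch β q n / qPoch (q / β) q n)) := by
      rw [qPoch_neg_div_qPoch_neg hq0 hβ (div_ne_zero hq0 hβ), show q / (q / β) = β by field_simp,
        show q / β / β = q / β ^ 2 by field_simp, div_eq_mul_inv]
      ring
    rw [hval]
    suffices hf : _ = _ from Eq.mpr (congrArg (fun f : ℕ → ℂ => HasSum f _) hf) h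
    · funext k
      rw [show ((k + n : ℕ) : ℤ) + -(n : ℤ) = k by push_cast; ring, pow_add, Nat.cast_add]
      ring

end Bilateral

/-! ### Absolute convergence of the double series. -/

section Bilateral

variable {q β γ ρ : ℂ}

/-- For n = -N, reflecting the three quotients produces the power β^{2N}, which against β^{-N}
leaves β^N; the remaining factorials have nonnegative index and are bounded. -/
theorem exists_norm_bilateralCoeff_le (hq0 : q ≠ 0) (hq : ‖q‖ < 1) (hβ : β ≠ 0) (hγ : γ ≠ 0)
    (hρ : ρ ≠ 0) (m : ℕ) (hγq : ∀ j : ℕ, γ * q ^ j ≠ 1) (hρq : ∀ j : ℕ, ρ ≠ q ^ (j + 1))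
    (hx : ∀ j : ℕ, β * ρ / γ * q ^ j ≠ q ^ m) :
    ∃ C : ℝ, 0 < C ∧ ∀ n : ℤ, ‖bilateralCoeff q β γ ρ m n‖ ≤ C * ‖β‖ ^ n.natAbs := by
  have hqm : q ^ m ≠ 0 := pow_ne_zero _ hq0
  have hq1m : q ^ (1 + m) ≠ 0 := pow_ne_zero _ hq0
  obtain ⟨A₁, a₁, hA₁⟩ := exists_norm_qPoch_le hq (1 / γ)
  obtain ⟨A₂, a₂, hA₂⟩ := exists_norm_qPoch_le hq ρ
  obtain ⟨A₃, a₃, hA₃⟩ := exists_norm_qPoch_le hq (γ * q ^ (1 + m) / (β * ρ))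
  obtain ⟨A₄, a₄, hA₄⟩ := exists_norm_inv_qPoch_le hq hγq
  obtain ⟨A₅, a₅, hA₅⟩ := exists_norm_inv_qPoch_le hq (a := q ^ (1 + m) / ρ) fun j h => by
    apply hρq (m + j)
    rw [div_mul_eq_mul_div, div_eq_one_iff_eq hρ] at h
    rw [← h]
    ring
  obtain ⟨A₆, a₆, hA₆⟩ := exists_norm_inv_qPoch_le hq (a := β * ρ / γ) fun j h => by
    apply hx (j + m)
    rw [pow_add, ← mul_assoc, h, one_mul]
  obtain ⟨B₁, b₁, hB₁⟩ := exists_norm_qPoch_le hq (q / γ)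
  obtain ⟨B₂, b₂, hB₂⟩ := exists_norm_qPoch_le hq (q / (q ^ (1 + m) / ρ))
  obtain ⟨B₃, b₃, hB₃⟩ := exists_norm_qPoch_le hq (q / (β * ρ / γ))
  obtain ⟨B₄, b₄, hB₄⟩ := exists_norm_inv_qPoch_le hq (a := q / (1 / γ)) fun j h => by
    apply hγq (j + 1)
    rw [← h, pow_succ]
    field_simp
  obtain ⟨B₅, b₅, hB₅⟩ := exists_norm_inv_qPoch_le hq (a := q / ρ) fun j h => by
    apply hρq j
    rw [div_mul_eq_mul_div, div_eq_one_iff_eq hρ] at h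
    rw [← h]
    ring
  obtain ⟨B₆, b₆, hB₆⟩ := exists_norm_inv_qPoch_le hq (a := q / (γ * q ^ (1 + m) / (β * ρ)))
    fun j h => by
      apply hx j
      rw [pow_add, pow_one] at h
      field_simp at h
      rw [div_mul_eq_mul_div, div_eq_iff hγ]
      linear_combination h
  refine ⟨max (A₁ * (A₂ * A₃) * (A₄ * (A₅ * A₆))) (B₁ * (B₂ * B₃) * (B₄ * (B₅ * B₆))),
    lt_max_of_lt_left (by positivity), fun n => ?_⟩
  obtain ⟨N, rfl | rfl⟩ := Int.eq_nat_or_neg n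
  · have e : bilateralCoeff q β γ ρ m N = qPoch (1 / γ) q N * (qPoch ρ q N *
        qPoch (γ * q ^ (1 + m) / (β * ρ)) q N) * ((qPoch γ q N)⁻¹ *
        ((qPoch (q ^ (1 + m) / ρ) q N)⁻¹ * (qPoch (β * ρ / γ) q N)⁻¹)) * β ^ N := by
      simp only [bilateralCoeff, qPochs, List.map_cons, List.map_nil, List.prod_cons,
        List.prod_nil, mul_one, zpow_natCast, div_eq_mul_inv _ (qPoch _ _ _ * _), mul_inv]
    rw [e, Int.natAbs_natCast, norm_mul, norm_pow]
    gcongr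
    refine le_trans ?_ (le_max_left _ _)
    simp only [norm_mul]
    gcongr
    exacts [hA₁ N, hA₂ N, hA₃ N, hA₄ N, hA₅ N, hA₆ N]
  · have e : bilateralCoeff q β γ ρ m (-(N : ℤ)) = qPoch (q / γ) q N *
        (qPoch (q / (q ^ (1 + m) / ρ)) q N * qPoch (q / (β * ρ / γ)) q N) *
        ((qPoch (q / (1 / γ)) q N)⁻¹ * ((qPoch (q / ρ) q N)⁻¹ *
          (qPoch (q / (γ * q ^ (1 + m) / (β * ρ))) q N)⁻¹)) * β ^ N := by
      have r1 := qPoch_neg_div_qPoch_neg hq0 (one_div_ne_zero hγ) hγ N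
      have r2 := qPoch_neg_div_qPoch_neg hq0 hρ (div_ne_zero hq1m hρ) N
      have r3 := qPoch_neg_div_qPoch_neg hq0 (div_ne_zero (mul_ne_zero hγ hq1m)
        (mul_ne_zero hβ hρ)) (div_ne_zero (mul_ne_zero hβ hρ) hγ) N
      simp only [bilateralCoeff, qPochs, List.map_cons, List.map_nil, List.prod_cons,
        List.prod_nil, mul_one]
      rw [mul_div_mul_comm, mul_div_mul_comm, r1, r2, r3, zpow_neg, zpow_natCast]
      have hp : (γ / (1 / γ)) ^ N * (q ^ (1 + m) / ρ / ρ) ^ N *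
          (β * ρ / γ / (γ * q ^ (1 + m) / (β * ρ))) ^ N * (β ^ N)⁻¹ = β ^ N := by
        rw [← mul_pow, ← mul_pow, ← inv_pow, ← mul_pow]
        congr 1
        field_simp
      generalize (β ^ N)⁻¹ = v at *
      rw [← hp]
      generalize (γ / (1 / γ)) ^ N = w₁
      generalize (q ^ (1 + m) / ρ / ρ) ^ N = w₂
      generalize (β * ρ / γ / (γ * q ^ (1 + m) / (β * ρ))) ^ N = w₃
      ring
    rw [e, Int.natAbs_neg, Int.natAbs_natCast, norm_mul, norm_pow]
    gcongr
    refine le_trans ?_ (le_max_right _ _)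
    simp only [norm_mul]
    gcongr
    exacts [hB₁ N, hB₂ N, hB₃ N, hB₄ N, hB₅ N, hB₆ N]

/-- The summand of the double series obtained from the bilateral series by the `q`-Gauss sum. -/
noncomputable def doubleTerm (q β γ ρ : ℂ) (m : ℕ) (p : ℤ × ℕ) : ℂ :=
  bilateralCoeff q β γ ρ m p.1 * (qPoch β q p.2 * qPoch β q (p.2 + (m + 2 * p.1)) *
    ((qPoch q q p.2)⁻¹ * (qPoch q q (p.2 + (m + 2 * p.1)))⁻¹)) * (q / β ^ 2) ^ (p.1 + p.2)

theorem summable_pow_natAbs {y : ℝ} (h0 : 0 ≤ y) (h1 : y < 1) :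
    Summable fun n : ℤ => y ^ n.natAbs := by
  have := summable_geometric_of_lt_one h0 h1
  exact Summable.of_nat_of_neg (by simpa using this) (by simpa using this)

theorem summable_doubleTerm (hq0 : q ≠ 0) (hq : ‖q‖ < 1) (hβ : β ≠ 0) (hγ : γ ≠ 0)
    (hρ : ρ ≠ 0) (m : ℕ) (hγq : ∀ j : ℕ, γ * q ^ j ≠ 1) (hρq : ∀ j : ℕ, ρ ≠ q ^ (j + 1))
    (hx : ∀ j : ℕ, β * ρ / γ * q ^ j ≠ q ^ m) (hz : ‖q / β ^ 2‖ < 1) :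
    Summable (doubleTerm q β γ ρ m) := by
  obtain ⟨C, c, hC⟩ := exists_norm_bilateralCoeff_le hq0 hq hβ hγ hρ m hγq hρq hx
  obtain ⟨A, a, hA⟩ := exists_norm_qPoch_le hq β
  obtain ⟨D, d, hD⟩ := exists_norm_inv_qPoch_le hq (self_mul_pow_ne_one hq)
  have hz0 : 0 < ‖q / β ^ 2‖ := norm_pos_iff.mpr (div_ne_zero hq0 (pow_ne_zero _ hβ))
  set Z := ‖q / β ^ 2‖ with hZ
  -- The product B·Z is the larger of |q/β²| and |q/β|, both less than 1.
  set B := max 1 ‖β‖ with hB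
  have hB1 : 1 ≤ B := le_max_left _ _
  have hx1 : B * Z < 1 := by
    rw [hB, max_mul_of_nonneg _ _ hz0.le, one_mul, hZ, ← norm_mul]
    refine max_lt hz ?_
    rw [show β * (q / β ^ 2) = q / β by field_simp]
    exact norm_div_lt_one_of_norm_div_sq hq hz
  have hx0 : 0 < B * Z := by positivity
  set y := Real.sqrt (B * Z) with hy
  have hy0 : 0 ≤ y := Real.sqrt_nonneg _
  have hy1 : y < 1 := by rw [hy, Real.sqrt_lt' one_pos, one_pow]; exact hx1
  have hy2 : B * Z = y ^ 2 := (Real.sq_sqrt hx0.le).symm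
  have hsum : Summable fun p : ℤ × ℕ => y ^ (p.2 + (m + 2 * p.1) : ℤ).natAbs * y ^ p.2 := by
    have h := (summable_pow_natAbs hy0 hy1).mul_of_nonneg (summable_geometric_of_lt_one hy0 hy1)
      (fun _ => pow_nonneg hy0 _) (fun _ => pow_nonneg hy0 _)
    refine h.comp_injective (i := fun p : ℤ × ℕ => ((p.2 + (m + 2 * p.1) : ℤ), p.2)) ?_
    rintro ⟨n, k⟩ ⟨n', k'⟩ hnk
    simp only [Prod.mk.injEq] at hnk ⊢
    omega
  refine Summable.of_norm_bounded (hsum.mul_left (C * (A * A * (D * D)) * Z⁻¹ ^ m)) ?_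
  rintro ⟨n, k⟩
  simp only [doubleTerm]
  -- Terms with l = k + m + 2n < 0 vanish. Otherwise t = n + k + m satisfies |n| ≤ t and k + l = 2t
  -- - m, so (BZ)^t = y^{2t} is at most y^{k+l}.
  rcases lt_or_ge ((k : ℤ) + (m + 2 * n)) 0 with hneg | hpos
  · rw [qPoch_self_of_neg hq0 hneg]
    simp only [inv_zero, mul_zero, zero_mul, norm_zero]
    positivity
  · obtain ⟨l, hl⟩ : ∃ l : ℕ, (k : ℤ) + (m + 2 * n) = l := ⟨_, (Int.toNat_of_nonneg hpos).symm⟩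
    obtain ⟨t, ht⟩ : ∃ t : ℕ, n + k + m = t := ⟨(n + k + m).toNat, by omega⟩
    rw [hl, Int.natAbs_natCast, show n + (k : ℤ) = t - m by omega]
    have h1 : ‖β‖ ^ n.natAbs ≤ B ^ t :=
      (pow_le_pow_left₀ (norm_nonneg _) (le_max_right _ _) _).trans
        (pow_le_pow_right₀ hB1 (by omega))
    have h2 : ‖(q / β ^ 2) ^ ((t : ℤ) - m)‖ = Z ^ t * Z⁻¹ ^ m := by
      rw [norm_zpow, zpow_sub₀ hz0.ne', zpow_natCast, zpow_natCast, inv_pow, div_eq_mul_inv]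
    have h3 : B ^ t * Z ^ t ≤ y ^ l * y ^ k := by
      rw [← mul_pow, hy2, ← pow_mul, ← pow_add]
      exact pow_le_pow_of_le_one hy0 hy1.le (by omega)
    have h4 : ‖bilateralCoeff q β γ ρ m n‖ ≤ C * B ^ t := (hC n).trans (by gcongr)
    have h5 : ‖qPoch β q k * qPoch β q l * ((qPoch q q k)⁻¹ * (qPoch q q l)⁻¹)‖ ≤
        A * A * (D * D) := by
      simp only [norm_mul]
      gcongr
      exacts [hA k, hA l, hD k, hD l]
    rw [norm_mul, norm_mul, h2]
    calc _ ≤ C * B ^ t * (A * A * (D * D)) * (Z ^ t * Z⁻¹ ^ m) := by gcongr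
      _ = C * (A * A * (D * D)) * Z⁻¹ ^ m * (B ^ t * Z ^ t) := by ring
      _ ≤ _ := by gcongr

end Bilateral

/-! ### Regrouping the double series and the final statement. -/

section Bilateral

variable {q β γ ρ : ℂ}

theorem qPoch_natCast_add_intCast {a : ℂ} (hq0 : q ≠ 0) (m : ℕ) (h : ∀ j : ℤ, j < m → a * q ^ j ≠ 1)
    (N : ℤ) : qPoch a q (m + N) = qPoch a q m * qPoch (a * q ^ m) q N := by
  have e : ∀ i : ℤ, a * q ^ m * q ^ i = a * q ^ (m + i : ℤ) := fun i => by
    rw [mul_assoc, zpow_add₀ hq0, zpow_natCast]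
  have s1 : ∀ i : ℤ, qPoch a q (m + (i + 1)) = qPoch a q (m + i) * (1 - a * q ^ (m + i : ℤ)) :=
    fun i => by
      rw [← add_assoc]
      refine qPoch_add_one _ _ _ ?_
      rcases le_or_gt 0 ((m : ℤ) + i) with hi | hi
      · exact Or.inl hi
      · exact Or.inr (h _ (by omega))
  have s2 : ∀ i : ℤ, qPoch (a * q ^ m) q (i + 1) =
      qPoch (a * q ^ m) q i * (1 - a * q ^ (m + i : ℤ)) := fun i => by
    rw [← e]
    refine qPoch_add_one _ _ _ ?_
    rcases le_or_gt 0 i with hi | hi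
    · exact Or.inl hi
    · exact Or.inr (by rw [e]; exact h _ (by omega))
  induction N using Int.induction_on with
  | zero => simp [qPoch_zero]
  | succ i ih => rw [s1, s2, ih, mul_assoc]
  | pred i ih =>
    have t1 := s1 (-i - 1)
    have t2 := s2 (-i - 1)
    rw [sub_add_cancel] at t1 t2
    rw [t1, t2, ← mul_assoc] at ih
    exact mul_right_cancel₀ (sub_ne_zero.mpr (h _ (by omega)).symm) ih

/-- Stated for reciprocals so that a may be a positive power of q: reciprocals at negative index are
products that may vanish. This is needed for a = q/β, where only |a| < 1 is known. -/
theorem inv_qPoch_natCast_add_intCast {a : ℂ} (hq0 : q ≠ 0) (m : ℕ) (h : ∀ j : ℕ, a * q ^ j ≠ 1)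
    (N : ℤ) : (qPoch a q (m + N))⁻¹ = (qPoch a q m)⁻¹ * (qPoch (a * q ^ m) q N)⁻¹ := by
  have e : ∀ i : ℤ, a * q ^ m * q ^ i = a * q ^ (m + i : ℤ) := fun i => by
    rw [mul_assoc, zpow_add₀ hq0, zpow_natCast]
  have h' : ∀ j : ℤ, 0 ≤ j → a * q ^ j ≠ 1 := fun j hj => by
    lift j to ℕ using hj
    rw [zpow_natCast]
    exact h j
  have s1 : ∀ i : ℤ, (qPoch a q (m + i))⁻¹ =
      (1 - a * q ^ (m + i : ℤ)) * (qPoch a q (m + (i + 1)))⁻¹ := fun i => by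
    rw [← add_assoc]
    refine inv_qPoch_eq _ _ _ ?_
    rcases lt_or_ge ((m : ℤ) + i) 0 with hi | hi
    · exact Or.inl hi
    · exact Or.inr (h' _ hi)
  have s2 : ∀ i : ℤ, (qPoch (a * q ^ m) q i)⁻¹ =
      (1 - a * q ^ (m + i : ℤ)) * (qPoch (a * q ^ m) q (i + 1))⁻¹ := fun i => by
    rw [← e]
    refine inv_qPoch_eq _ _ _ ?_
    rcases lt_or_ge i 0 with hi | hi
    · exact Or.inl hi
    · exact Or.inr (by rw [e]; exact h' _ (by omega))
  induction N using Int.induction_on with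
  | zero => simp [qPoch_zero]
  | succ i ih =>
    rw [s1, s2, mul_left_comm] at ih
    exact mul_left_cancel₀ (sub_ne_zero.mpr (h' _ (by omega)).symm) ih
  | pred i ih =>
    rw [s1, s2, sub_add_cancel, ih, mul_left_comm]

theorem qHypTerm_eq_mul_pow (as bs : List ℂ) (z : ℂ) (k : ℕ) :
    qHypTerm as bs q z k = qHypTerm as bs q 1 k * z ^ k := by
  simp [qHypTerm]

theorem summable_qHypTerm_four (hq : ‖q‖ < 1) {a₁ a₂ a₃ a₄ b₁ b₂ b₃ z : ℂ}
    (h₁ : ∀ j : ℕ, b₁ * q ^ j ≠ 1) (h₂ : ∀ j : ℕ, b₂ * q ^ j ≠ 1) (h₃ : ∀ j : ℕ, b₃ * q ^ j ≠ 1)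
    (hz : ‖z‖ < 1) : Summable (qHypTerm [a₁, a₂, a₃, a₄] [b₁, b₂, b₃] q z) := by
  obtain ⟨A₁, p₁, hA₁⟩ := exists_norm_qPoch_le hq a₁
  obtain ⟨A₂, p₂, hA₂⟩ := exists_norm_qPoch_le hq a₂
  obtain ⟨A₃, p₃, hA₃⟩ := exists_norm_qPoch_le hq a₃
  obtain ⟨A₄, p₄, hA₄⟩ := exists_norm_qPoch_le hq a₄
  obtain ⟨B₀, r₀, hB₀⟩ := exists_norm_inv_qPoch_le hq (self_mul_pow_ne_one hq)
  obtain ⟨B₁, r₁, hB₁⟩ := exists_norm_inv_qPoch_le hq h₁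
  obtain ⟨B₂, r₂, hB₂⟩ := exists_norm_inv_qPoch_le hq h₂
  obtain ⟨B₃, r₃, hB₃⟩ := exists_norm_inv_qPoch_le hq h₃
  refine Summable.of_norm_bounded (g := fun k =>
    A₁ * (A₂ * (A₃ * A₄)) * (B₀ * (B₁ * (B₂ * B₃))) * ‖z‖ ^ k)
    ((summable_geometric_of_lt_one (norm_nonneg z) hz).mul_left _) fun k => ?_
  rw [qHypTerm_four]
  simp only [norm_mul, norm_pow]
  gcongr
  exacts [hA₁ k, hA₂ k, hA₃ k, hA₄ k, hB₀ k, hB₁ k, hB₂ k, hB₃ k]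

theorem lhsTerm_eq (hq0 : q ≠ 0) (hq : ‖q‖ < 1) (hβ : β ≠ 0) (hz : ‖q / β ^ 2‖ < 1) (m : ℕ)
    (hβq : ∀ j : ℕ, j < m → β * q ^ j ≠ 1) (n : ℤ) :
    qPoch β q m / qPoch (q / β) q m * lhsTerm q β γ ρ m n =
      bilateralCoeff q β γ ρ m n *
        (qPoch β q (m + 2 * n) / qPoch (q / β) q (m + 2 * n)) * (q / β ^ 2) ^ n := by
  have hβz := norm_div_lt_one_of_norm_div_sq hq hz
  have hb := mul_pow_ne_one_of_norm_lt_one hq hβz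
  -- For j < 0 the equality would make (q/β)q^i = 1 for some i ≥ 0, contradicting |q/β| < 1.
  have hneg : ∀ j : ℤ, j < m → β * q ^ j ≠ 1 := by
    intro j hj h
    rcases le_or_gt 0 j with h0 | h0
    · lift j to ℕ using h0
      rw [zpow_natCast] at h
      exact hβq j (by omega) h
    · obtain ⟨i, rfl⟩ : ∃ i : ℕ, j = -((i + 1 : ℕ) : ℤ) := ⟨(-j - 1).toNat, by omega⟩
      apply hb i
      rw [zpow_neg, zpow_natCast, mul_inv_eq_one₀ (pow_ne_zero _ hq0)] at h
      rw [h, pow_succ]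
      field_simp
  rw [qPoch_natCast_add_intCast hq0 m hneg, div_eq_mul_inv _ (qPoch (q / β) q (m + 2 * n)),
    inv_qPoch_natCast_add_intCast hq0 m hb, lhsTerm, bilateralCoeff,
    show q / β * q ^ m = q ^ (1 + m) / β by rw [pow_add, pow_one]; ring,
    show q / β = β * (q / β ^ 2) by field_simp, mul_zpow]
  simp only [div_eq_mul_inv]
  ring

/-- The theorem for complex parameters, with the constant in front of the right-hand side
written as the inverse of `gaussConst`. -/
theorem hasSum_bilateral (hq0 : q ≠ 0) (hq : ‖q‖ < 1) (hβ : β ≠ 0) (hγ : γ ≠ 0)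
    (hρ : ρ ≠ 0) (m : ℕ) (hγq : ∀ j : ℕ, γ * q ^ j ≠ 1) (hρq : ∀ j : ℕ, ρ ≠ q ^ (j + 1))
    (hx : ∀ j : ℕ, β * ρ / γ * q ^ j ≠ q ^ m) (hz : ‖q / β ^ 2‖ < 1) :
    HasSum (fun n : ℤ => bilateralCoeff q β γ ρ m n * (gaussConst q β *
        (qPoch β q (m + 2 * n) / qPoch (q / β) q (m + 2 * n))) * (q / β ^ 2) ^ n)
      (∑ s ∈ Finset.range (m / 2 + 1), rhsCoeff q β γ ρ m s *
        qHyp (upperParams q β γ ρ m s) (lowerParams q β γ ρ m s) q (q / β ^ 2)) := by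
  have hzne : q / β ^ 2 ≠ 0 := div_ne_zero hq0 (pow_ne_zero _ hβ)
  have hE := (summable_doubleTerm hq0 hq hβ hγ hρ m hγq hρq hx hz).hasSum
  have fib1 := hE.prod_fiberwise (g := fun n : ℤ => bilateralCoeff q β γ ρ m n * (gaussConst q β *
      (qPoch β q (m + 2 * n) / qPoch (q / β) q (m + 2 * n))) * (q / β ^ 2) ^ n) fun n => by
    have h := ((hasSum_convolution hq0 hq hβ hz (m + 2 * n)).mul_left
      (bilateralCoeff q β γ ρ m n)).mul_right ((q / β ^ 2) ^ n)
    refine Eq.mpr (congrArg (fun f : ℕ → ℂ => HasSum f _) (funext fun k => ?_)) h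
    rw [doubleTerm, zpow_add₀ hzne, zpow_natCast]
    ring
  -- Reindexing by L = n + k collects equal powers of q/β².
  let φ : ℤ × ℕ ≃ ℤ × ℕ :=
    { toFun := fun p => (p.1 - p.2, p.2)
      invFun := fun p => (p.1 + p.2, p.2)
      left_inv := fun p => by simp
      right_inv := fun p => by simp }
  set V : ℤ → ℂ := fun L => ∑ s ∈ Finset.range (m / 2 + 1), rhsCoeff q β γ ρ m s *
      (if 0 ≤ L + s then
        qHypTerm (upperParams q β γ ρ m s) (lowerParams q β γ ρ m s) q (q / β ^ 2) (L + s).toNat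
      else 0) with hV
  have fib2 := (φ.hasSum_iff.mpr hE).prod_fiberwise (g := V) fun L => by
    have hterm : ∀ k : ℕ, (doubleTerm q β γ ρ m ∘ φ) (L, k) =
        bilateralCoeff q β γ ρ m (L - k) * (qPoch β q k * qPoch β q (m + 2 * L - k) *
          ((qPoch q q k)⁻¹ * (qPoch q q (m + 2 * L - k))⁻¹)) * (q / β ^ 2) ^ L := fun k => by
      show doubleTerm q β γ ρ m (L - k, k) = _
      simp only [doubleTerm]
      rw [show (k : ℤ) + (m + 2 * (L - k)) = m + 2 * L - k by ring, sub_add_cancel]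
    rcases lt_or_ge ((m : ℤ) + 2 * L) 0 with hneg | hpos
    · have hV0 : V L = 0 := by
        rw [hV]
        refine Finset.sum_eq_zero fun s hs => ?_
        have := Finset.mem_range.mp hs
        rw [if_neg (by omega), mul_zero]
      rw [hV0]
      have h0 : ∀ k : ℕ, (doubleTerm q β γ ρ m ∘ φ) (L, k) = 0 := fun k => by
        rw [hterm, qPoch_self_of_neg hq0 (show (m : ℤ) + 2 * L - k < 0 by omega)]
        simp
      simp only [h0]
      exact hasSum_zero
    · obtain ⟨M, hM⟩ : ∃ M : ℕ, (M : ℤ) = m + 2 * L := ⟨_, Int.toNat_of_nonneg hpos⟩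
      have hVL : V L = ∑ k ∈ Finset.range (M + 1), (doubleTerm q β γ ρ m ∘ φ) (L, k) := by
        simp only [hterm, ← hM]
        rw [← Finset.sum_mul, finite_identity hq0 hq hβ hγ hρ m M L hM hγq hρq hx, hV,
          Finset.sum_mul]
        refine Finset.sum_congr rfl fun s _ => ?_
        split_ifs with hs
        · rw [qHypTerm_eq_mul_pow _ _ (q / β ^ 2)]
          have : (q / β ^ 2) ^ (L + s).toNat = (q / β ^ 2) ^ s * (q / β ^ 2) ^ L := by
            rw [← zpow_natCast, Int.toNat_of_nonneg hs, zpow_add₀ hzne, zpow_natCast, mul_comm]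
          rw [this]
          ring
        · simp
      rw [hVL]
      refine hasSum_sum_of_ne_finset_zero fun k hk => ?_
      rw [hterm, qPoch_self_of_neg hq0 (show (m : ℤ) + 2 * L - k < 0 by
        simp only [Finset.mem_range] at hk; omega)]
      simp
  have hsumV : HasSum V (∑ s ∈ Finset.range (m / 2 + 1), rhsCoeff q β γ ρ m s *
        qHyp (upperParams q β γ ρ m s) (lowerParams q β γ ρ m s) q (q / β ^ 2)) := by
    refine hasSum_sum fun s hs => HasSum.mul_left _ ?_
    have hs' : 2 * s ≤ m := by have := Finset.mem_range.mp hs; omega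
    have hl := lowerParams_ne hq0 m hρ hγq hρq hx hs'
    have hsm : Summable (qHypTerm (upperParams q β γ ρ m s) (lowerParams q β γ ρ m s) q
        (q / β ^ 2)) :=
      summable_qHypTerm_four hq (fun j => (hl j).1) (fun j => (hl j).2.1) (fun j => (hl j).2.2) hz
    have hinj : Function.Injective fun k : ℕ => (k : ℤ) - s := fun a b hab => by
      simp only at hab
      omega
    -- The summand at L is term L + s of the series with index s and is zero for L < -s, so summing
    -- over L = k - s recovers that series.
    rw [← hinj.hasSum_iff]
    · refine Eq.mpr (congrArg (fun f : ℕ → ℂ => HasSum f _) (funext fun k => ?_)) hsm.hasSum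
      simp only [Function.comp_apply, sub_add_cancel, Int.toNat_natCast]
      rw [if_pos (Int.natCast_nonneg k)]
    · intro L hL
      rw [if_neg]
      intro h0
      exact hL ⟨(L + s).toNat, by simp only [Int.toNat_of_nonneg h0]; ring⟩
  rw [hsumV.unique fib2]
  exact fib1

end Bilateral

theorem gaussConst_ne_zero {q β : ℂ} (hq : ‖q‖ < 1) (hz : ‖q / β ^ 2‖ < 1) :
    gaussConst q β ≠ 0 := by
  have h₁ := qPochInf_ne_zero hq
    (mul_pow_ne_one_of_norm_lt_one hq (norm_div_lt_one_of_norm_div_sq hq hz))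
  have h₂ := qPochInf_ne_zero hq (self_mul_pow_ne_one hq)
  have h₃ := qPochInf_ne_zero hq (mul_pow_ne_one_of_norm_lt_one hq hz)
  exact div_ne_zero (mul_ne_zero h₁ h₁) (mul_ne_zero h₂ h₃)

theorem theorem4p5 (q : ℂ) (hq0 : 0 < ‖q‖) (hq1 : ‖q‖ < 1) (m : ℕ) (β γ ρ : ℝ)
    (hβ : β ≠ 0) (hγ : γ ≠ 0) (hρ : ρ ≠ 0)
    -- none of the denominators in the identity vanishes
    (hβq : ∀ j : ℕ, j < m → (β : ℂ) * q ^ j ≠ 1)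
    (hγq : ∀ j : ℕ, (γ : ℂ) * q ^ j ≠ 1)
    (hρq : ∀ j : ℕ, (ρ : ℂ) ≠ q ^ (j + 1))
    (hβργ : ∀ j : ℕ, (β : ℂ) * ρ / γ * q ^ j ≠ q ^ m)
    (hconv : ‖q / (β : ℂ) ^ 2‖ < 1) :
    Summable (fun n : ℤ => lhsTerm q β γ ρ m n) ∧
    (∀ s ∈ Finset.range (m / 2 + 1),
      Summable (fun k : ℕ =>
        qHypTerm (upperParams q β γ ρ m s) (lowerParams q β γ ρ m s) q (q / (β : ℂ) ^ 2) k)) ∧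
    qPoch β q m / qPoch (q / β) q m * ∑' n : ℤ, lhsTerm q β γ ρ m n =
      qPochsInf [q, q / (β : ℂ) ^ 2] q / qPochsInf [q / β, q / β] q *
        ∑ s ∈ Finset.range (m / 2 + 1),
          rhsCoeff q β γ ρ m s *
            qHyp (upperParams q β γ ρ m s) (lowerParams q β γ ρ m s) q (q / (β : ℂ) ^ 2) := by
  have hq : q ≠ 0 := norm_pos_iff.mp hq0
  have hβ' : (β : ℂ) ≠ 0 := Complex.ofReal_ne_zero.mpr hβ
  have hγ' : (γ : ℂ) ≠ 0 := Complex.ofReal_ne_zero.mpr hγ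
  have hρ' : (ρ : ℂ) ≠ 0 := Complex.ofReal_ne_zero.mpr hρ
  have key := hasSum_bilateral hq hq1 hβ' hγ' hρ' m hγq hρq hβργ hconv
  have hD := gaussConst_ne_zero hq1 hconv
  have hb := mul_pow_ne_one_of_norm_lt_one hq1 (norm_div_lt_one_of_norm_div_sq hq1 hconv)
  have hp : qPoch (β : ℂ) q m / qPoch (q / β) q m ≠ 0 :=
    div_ne_zero (qPoch_natCast_ne_zero m hβq) (qPoch_natCast_ne_zero m fun j _ => hb j)
  have hterm : (fun n : ℤ => bilateralCoeff q (β : ℂ) γ ρ m n * (gaussConst q β *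
      (qPoch (β : ℂ) q (m + 2 * n) / qPoch (q / β) q (m + 2 * n))) * (q / (β : ℂ) ^ 2) ^ n) =
      fun n => gaussConst q β * (qPoch (β : ℂ) q m / qPoch (q / β) q m) *
        lhsTerm q β γ ρ m n := by
    funext n
    rw [mul_assoc (gaussConst q β), lhsTerm_eq hq hq1 hβ' hconv m hβq n]
    ring
  rw [hterm] at key
  -- The constant is nonzero, so summability passes back to the original bilateral series; in ℂ this
  -- is absolute convergence.
  refine ⟨(summable_mul_left_iff (mul_ne_zero hD hp)).mp key.summable, fun s hs => ?_, ?_⟩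
  · have hl := lowerParams_ne hq m hρ' hγq hρq hβργ (s := s)
      (by have := Finset.mem_range.mp hs; omega)
    exact summable_qHypTerm_four hq1 (fun j => (hl j).1) (fun j => (hl j).2.1)
      (fun j => (hl j).2.2) hconv
  · have hC : qPochsInf [q, q / (β : ℂ) ^ 2] q / qPochsInf [q / β, q / β] q =
        (gaussConst q β)⁻¹ := by
      simp [qPochsInf, gaussConst]
    rw [hC, ← key.tsum_eq, tsum_mul_left, mul_assoc (gaussConst q β), inv_mul_cancel_left₀ hD]
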